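/- **Setting.** Consider a connected graph on a finite set $\mathcal L\cup\mathcal I$ of buses, with $n\ge 1$ load buses $\mathcal L$ and $m\ge 1$ inverter buses $\mathcal I$, whose branches are purely inductive, with susceptances $b_{ij}=b_{ji}<0$. The susceptance matrix $B$ has the entries $B_{ij}=-b_{ij}$ on branches $\{i,j\}$, $B_{ij}=0$ for the other pairs $i\neq j$, and $B_{ii}=\sum_{j\neq i}b_{ij}$; partition it into $B_{LL},B_{LI},B_{IL},B_{II}$, and the voltages into $E=(E_L,E_I)$. Let the inverters have time constants $\tau_i>0$, gains $K_i<0$ and set points $E_i^*>0$ ($i\in\mathcal I$), with $\tau_I,K_I$ the corresponding diagonal matrices and $E_I^*$ the vector of set points, and let $T$ be a diagonal matrix of positive time constants of the loads. Write $[x]$ for the diagonal matrix with diagonal $x$. With dynamic shunt loads of constant demands $Q_L=(Q_i)_{i\in\mathcal L}$ the extended closed-loop system under quadratic droop control is, on positive voltages, the differential-algebraic system $$\begin{pmatrix}0\\ \tau_I\dot E_I\end{pmatrix}=\begin{pmatrix}[E_L]^2b\\ [E_I]K_I(E_I-E_I^*)\end{pmatrix}+[E]BE,\qquad T\dot b=Q_L-[E_L]^2b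 .\tag{1}$$ Define $B_{\rm red}=B_{LL}-B_{LI}(B_{II}+K_I)^{-1}B_{IL}$, $E_L^*=-B_{\rm red}^{-1}B_{LI}(B_{II}+K_I)^{-1}K_IE_I^*$ and $Q_{\rm sc}=[E_L^*]B_{\rm red}[E_L^*]$, and consider the reduced power flow equation together with the steady state of the loads, $$0=[E_L]^2b+[E_L]B_{\rm red}(E_L-E_L^*),\qquad 0=Q_L-[E_L]^2b .\tag{2}$$ **Theorem (Stability with Dynamic Shunt Loads).** There is a constant $C>0$ such that for every $c\in(0,1)$ there is $\delta>0$ such that the following holds for all $Q_L\in\mathbb R^n$ with $Q_i<0$ for all $i\in\mathcal L$ and $\|Q_L\|<\delta$. There is a unique high-voltage solution $(E_L^{\rm DS},b^{\rm DS})\in\mathbb R^n_{>0}\times\mathbb R^n_{<0}$ of (2), that is, a unique one with $E_L^{\rm DS}>c\,E_L^*$ component-wise. It is given by $$E_L^{\rm DS}=[E_L^*]\left(\mathbf 1-Q_{\rm sc}^{-1}Q_L+\epsilon\right),\qquad b^{\rm DS}=[E_L^{\rm DS}]^{-2}Q_L,\qquad \|\epsilon\|\le C\,\|Q_{\rm sc}^{-1}Q_L\|^2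 .$$ There is exactly one $E_I^{\rm DS}$ for which $(E_L^{\rm DS},E_I^{\rm DS},b^{\rm DS})$ is an equilibrium point of (1), namely $E_I^{\rm DS}=(B_{II}+K_I)^{-1}(K_IE_I^*-B_{IL}E_L^{\rm DS})$, and this equilibrium point is locally exponentially stable. Here local exponential stability means: near the equilibrium point each $(E_I,b)$ extends to a state $(E_L,E_I,b)$ that satisfies the algebraic equation of (1), with $E_L$ at a distance from its equilibrium value bounded by a constant times that of $(E_I,b)$; from each state near the equilibrium point that satisfies the algebraic equation there starts a solution of (1) for all $t\ge0$; and there are $M,\alpha>0$ such that each solution that starts near the equilibrium point stays, at every time $t\ge 0$ up to which it is defined, within $Me^{-\alpha t}$ times its initial distance. -/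

import Mathlib

open Matrix

/-- An inductive microgrid with load buses `L` and inverter buses `I`, together with the parameters
of the quadratic droop controllers: a connected graph on the buses, the (negative) susceptances of
its branches, inverter time constants, controller gains and inverter set points. -/
structure Microgrid (L I : Type*) where
  /-- the network graph -/
  graph : SimpleGraph (L ⊕ I)
  connected : graph.Connected
  /-- branch susceptances: branch `{i, j}` has the admittance `√-1 * b i j` -/
  b : L ⊕ I → L ⊕ I → ℝ
  b_symm : ∀ i j, b i j = b j i
  b_neg : ∀ i j, graph.Adj i j → b i j < 0
  b_zero : ∀ i j, ¬ graph.Adj i j → b i j = 0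
  /-- time constants of the inverters -/
  τ : I → ℝ
  τ_pos : ∀ i, 0 < τ i
  /-- gains of the quadratic droop controllers -/
  K : I → ℝ
  K_neg : ∀ i, K i < 0
  /-- nominal voltages (set points) of the inverters -/
  Estar : I → ℝ
  Estar_pos : ∀ i, 0 < Estar i

namespace Microgrid

variable {L I : Type*} [Fintype L] [Fintype I] [DecidableEq L] [DecidableEq I] (N : Microgrid L I)

/-- The susceptance matrix `B`, the imaginary part of the bus admittance matrix:
`B i j = - b i j` for `i ≠ j`, and `B i i = ∑ j ≠ i, b i j`. -/
def B : Matrix (L ⊕ I) (L ⊕ I) ℝ :=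
  Matrix.of fun i j => if i = j then ∑ k ∈ Finset.univ.erase i, N.b i k else - N.b i j

/-- The diagonal matrix `K_I` of controller gains. -/
def KI : Matrix I I ℝ := diagonal N.K

/-- The reduced susceptance matrix `B_red = B_LL - B_LI (B_II + K_I)⁻¹ B_IL`. -/
noncomputable def Bred : Matrix L L ℝ :=
  N.B.toBlocks₁₁ - N.B.toBlocks₁₂ * (N.B.toBlocks₂₂ + N.KI)⁻¹ * N.B.toBlocks₂₁

/-- The averaging matrix `W₁ = - B_red⁻¹ B_LI (B_II + K_I)⁻¹ K_I`. -/
noncomputable def W₁ : Matrix L I ℝ :=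
  -(N.Bred⁻¹ * N.B.toBlocks₁₂ * (N.B.toBlocks₂₂ + N.KI)⁻¹ * N.KI)

/-- The averaging matrix `W₂ = (B_II + K_I)⁻¹ (-B_IL  K_I)`. -/
noncomputable def W₂ : Matrix I (L ⊕ I) ℝ :=
  (N.B.toBlocks₂₂ + N.KI)⁻¹ * fromCols (-N.B.toBlocks₂₁) N.KI

/-- The open-circuit load voltages `E_L^* = W₁ E_I^*`. -/
noncomputable def ELstar : L → ℝ := N.W₁ *ᵥ N.Estar

/-- The matrix `Q_sc = [E_L^*] B_red [E_L^*]`. -/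
noncomputable def Qsc : Matrix L L ℝ := diagonal N.ELstar * N.Bred * diagonal N.ELstar

/-- The inverter voltages `W₂ (E_L, E_I^*)` that correspond to the load voltages `E_L`. -/
noncomputable def inverterVoltages (EL : L → ℝ) : I → ℝ := N.W₂ *ᵥ Sum.elim EL N.Estar

/-- The shunt load model `Q_i(E_i) = b_i E_i ^ 2`. -/
def shuntLoad (b EL : L → ℝ) : L → ℝ := fun i => b i * EL i ^ 2

/-- `(E_L, b)` solves the reduced power flow equation `0 = Q_L(E_L) + [E_L] B_red (E_L - E_L^*)`
with the shunt load model, and the steady-state equation `0 = Q_L - [E_L]^2 b` of the dynamic shunt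
loads with constant power demands `QL`. -/
def IsReducedSolution (QL EL b : L → ℝ) : Prop :=
  (∀ i, 0 = shuntLoad b EL i + EL i * (N.Bred *ᵥ (EL - N.ELstar)) i) ∧
  (∀ i, 0 = QL i - EL i ^ 2 * b i)

/-- The upper block of the right-hand side of the closed loop: `Q_L(E_L) + ([E] B E)_L`. -/
def loadBalance (EL : L → ℝ) (EI : I → ℝ) (b : L → ℝ) : L → ℝ := fun i =>
  shuntLoad b EL i + EL i * (N.B *ᵥ Sum.elim EL EI) (Sum.inl i)

/-- The lower block of the right-hand side of the closed loop:
`[E_I] K_I (E_I - E_I^*) + ([E] B E)_I`. -/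
def inverterRHS (EL : L → ℝ) (EI : I → ℝ) : I → ℝ := fun i =>
  EI i * N.K i * (EI i - N.Estar i) + EI i * (N.B *ᵥ Sum.elim EL EI) (Sum.inr i)

/-- The vector field of the differential variables `(E_I, b)` of the extended closed loop, that is
`τ_I (d/dt) E_I = [E_I] K_I (E_I - E_I^*) + ([E] B E)_I` and `T (d/dt) b = Q_L - [E_L]^2 b`;
the algebraic variable is `E_L`. -/
noncomputable def vectorField (T QL : L → ℝ) (x : (I → ℝ) × (L → ℝ)) (EL : L → ℝ) :
    (I → ℝ) × (L → ℝ) :=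
  (fun i => N.inverterRHS EL x.1 i / N.τ i, fun i => (QL i - EL i ^ 2 * x.2 i) / T i)

/-- The states `((E_I, b), E_L)` of the extended closed loop: the voltages are positive and the
algebraic equation `0 = Q_L(E_L) + ([E] B E)_L` holds. -/
def stateSet : Set (((I → ℝ) × (L → ℝ)) × (L → ℝ)) :=
  {z | (∀ i, 0 < z.2 i) ∧ (∀ i, 0 < z.1.1 i) ∧ N.loadBalance z.2 z.1.1 z.1.2 = 0}

/-- `(E_L, E_I, b)` is an equilibrium point of the extended closed loop. -/
def IsEquilibrium (T QL : L → ℝ) (EL : L → ℝ) (EI : I → ℝ) (b : L → ℝ) : Prop :=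
  ((EI, b), EL) ∈ N.stateSet ∧ N.vectorField T QL (EI, b) EL = 0

end Microgrid

/-- `(x, y)` is on the time interval `s` a solution of the differential-algebraic system
`x' = f x y`, `(x, y) ∈ S`, with differential variable `x` and algebraic variable `y`. -/
def IsDAESolution {X Y : Type*} [NormedAddCommGroup X] [NormedSpace ℝ X] [NormedAddCommGroup Y]
    (f : X → Y → X) (S : Set (X × Y)) (s : Set ℝ) (x : ℝ → X) (y : ℝ → Y) : Prop :=
  ContinuousOn y s ∧
    ∀ t ∈ s, (x t, y t) ∈ S ∧ HasDerivWithinAt x (f (x t) (y t)) s t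

/-- Local exponential stability of the equilibrium `(xe, ye)` of the differential-algebraic system
`x' = f x y`, `(x, y) ∈ S`. Near the equilibrium the system is well posed: every differential
state extends to a consistent state near the equilibrium, and from every consistent state there is
a solution for all future time. Every solution that starts near the equilibrium converges to it
at a uniform exponential rate. -/
def IsLocallyExponentiallyStable {X Y : Type*} [NormedAddCommGroup X] [NormedSpace ℝ X]
    [NormedAddCommGroup Y] (f : X → Y → X) (S : Set (X × Y)) (xe : X) (ye : Y) : Prop :=
  ∃ r > (0 : ℝ), ∃ M > (0 : ℝ), ∃ α > (0 : ℝ),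
    (∀ x₀, ‖x₀ - xe‖ < r → ∃ y₀, (x₀, y₀) ∈ S ∧ ‖y₀ - ye‖ ≤ M * ‖x₀ - xe‖) ∧
    (∀ x₀ y₀, (x₀, y₀) ∈ S → ‖(x₀, y₀) - (xe, ye)‖ < r →
      ∃ x y, IsDAESolution f S (Set.Ici 0) x y ∧ x 0 = x₀ ∧ y 0 = y₀) ∧
    (∀ t₁ ≥ (0 : ℝ), ∀ x y, IsDAESolution f S (Set.Icc 0 t₁) x y →
      ‖(x 0, y 0) - (xe, ye)‖ < r → ∀ t ∈ Set.Icc 0 t₁,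
        ‖(x t, y t) - (xe, ye)‖ ≤ M * Real.exp (-α * t) * ‖(x 0, y 0) - (xe, ye)‖)

/-! Everything rests on one fact: `B + diag (0, K_I)` is negative definite (`exists_quadForm_le`).
The form of `B` is half the sum of `b i j * (x i - x j) ^ 2`; by connectedness it vanishes only on
constants, and the gains exclude the nonzero ones. Hence the matrices to be inverted are invertible,
and a minimum principle (`pos_of_inverter_balance`) makes `E_L^*` and the inverter voltages
positive.

Power flow (`exists_unique_highVoltage_solution`): with `E_L = [E_L^*](1 + v)`, (2) becomes the
fixed-point equation `v = -Q_sc⁻¹ (Q_L / (1 + v))`, a contraction for small demands. Its Lipschitz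
bound holds on the whole region `1 + v ≥ c`, which gives uniqueness among all high-voltage
solutions; comparing `Q_L / (1 + v)` with `Q_L` gives the expansion.

Stability: at positive `E_L` the algebraic equation can be divided by `E_L` and becomes linear in
it, with a unique solution, Lipschitz in `(E_I, b)`, as long as `b ≤ 0`. Let `y, u, w` be the
deviations of `E_L, E_I, b`, let `Y` be the current load voltage and `l` the definiteness constant.
The Lyapunov function is `∑ τ u² / E_I + ∑ T w² / l`, with `E_I` at equilibrium. To leading order
the inverter part of half its derivative is at most `-l (|u|² + |y|²)` plus the cross term `∑ Y y w`
and a nonpositive term. The load part supplies `-Y² w² / l`, which together with `-l y²` absorbs the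
cross term once `|b| ≤ l / 6` (`lyapunov_derivative_le`). Small demands ensure this, since `E_L ≥
E_L^* / 2`. The criterion `isLocallyExponentiallyStable_of_lyapunov` concludes. -/

section ODE

/-! ### Global solutions and a Lyapunov criterion for differential-algebraic systems. -/

open Set Metric
open scoped NNReal Topology

/-- A bounded, globally Lipschitz vector field has forward solutions for all time. -/
theorem exists_forall_hasDerivWithinAt_Ici_of_lipschitzWith {E : Type*} [NormedAddCommGroup E]
    [NormedSpace ℝ E] [CompleteSpace E] {v : E → E} {K L : ℝ≥0} (hv : LipschitzWith K v)
    (hL : ∀ x, ‖v x‖ ≤ L) (x₀ : E) :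
    ∃ x : ℝ → E, x 0 = x₀ ∧ ∀ t ∈ Ici (0 : ℝ), HasDerivWithinAt x (v (x t)) (Ici 0) t := by
  have hloc (n : ℕ) : ∃ γ : ℝ → E, γ 0 = x₀ ∧
      ∀ t ∈ Icc (0 : ℝ) n, HasDerivWithinAt γ (v (γ t)) (Icc 0 (n : ℝ)) t := by
    -- The ball of radius `L * n` cannot be left in time `n` at speed at most `L`, so a single
    -- Picard–Lindelöf step covers the interval.
    have hpl : IsPicardLindelof (fun _ => v) (⟨0, by simp⟩ : Icc (0 : ℝ) n) x₀ (L * n) 0 L K :=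
      { lipschitzOnWith := fun _ _ => hv.lipschitzOnWith
        continuousOn := fun _ _ => continuousOn_const
        norm_le := fun _ _ x _ => hL x
        mul_max_le := by simp }
    exact hpl.exists_eq_forall_mem_Icc_hasDerivWithinAt₀
  choose γ hγ0 hγ using hloc
  have hagree (n k : ℕ) (t : ℝ) (ht : 0 ≤ t) (hn : t ≤ n) (hk : t ≤ k) : γ n t = γ k t := by
    have key (n : ℕ) (hn : t ≤ n) : ContinuousOn (γ n) (Icc 0 t) ∧
        ∀ s ∈ Ico 0 t, HasDerivWithinAt (γ n) (v (γ n s)) (Ici s) s := by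
      refine ⟨fun s hs => ((hγ n s ⟨hs.1, hs.2.trans hn⟩).continuousWithinAt).mono
        (Icc_subset_Icc_right hn), fun s hs => ?_⟩
      refine (hγ n s ⟨hs.1, hs.2.le.trans hn⟩).mono_of_mem_nhdsWithin ?_
      exact Filter.mem_of_superset (Icc_mem_nhdsGE (hs.2.trans_le hn)) (Icc_subset_Icc_left hs.1)
    exact ODE_solution_unique_of_mem_Icc_right (v := fun _ => v) (s := fun _ => univ)
      (fun _ _ => hv.lipschitzOnWith) (key n hn).1 (key n hn).2 (fun _ _ => mem_univ _)
      (key k hk).1 (key k hk).2 (fun _ _ => mem_univ _) (by rw [hγ0, hγ0]) ⟨ht, le_rfl⟩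
  -- The extra 1 makes this strict, so each `t` has a right neighbourhood (two-sided if `t > 0`) on
  -- which the glued curve agrees with a single piece.
  have hceil (t : ℝ) : t < (⌈t⌉₊ + 1 : ℕ) := by
    push_cast
    linarith [Nat.le_ceil t]
  refine ⟨fun t => γ (⌈t⌉₊ + 1) t, by simpa using hγ0 _, fun t ht => ?_⟩
  have hd := (hγ (⌈t⌉₊ + 1) t ⟨ht, (hceil t).le⟩)
  have hd' : HasDerivWithinAt (γ (⌈t⌉₊ + 1)) (v (γ (⌈t⌉₊ + 1) t)) (Ici 0) t := by
    refine hd.mono_of_mem_nhdsWithin ?_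
    filter_upwards [self_mem_nhdsWithin, nhdsWithin_le_nhds (Iio_mem_nhds (hceil t))] with s h1 h2
    exact ⟨h1, le_of_lt h2⟩
  refine hd'.congr_of_eventuallyEq ?_ rfl
  filter_upwards [self_mem_nhdsWithin, nhdsWithin_le_nhds (Iio_mem_nhds (hceil t))] with s h1 h2
  exact hagree _ _ s h1 (hceil s).le (le_of_lt h2)

/-- The radial retraction of a normed space onto a closed ball is Lipschitz. -/
theorem exists_lipschitzWith_retraction_closedBall {E : Type*} [NormedAddCommGroup E]
    [NormedSpace ℝ E] (e : E) {r : ℝ} (hr : 0 < r) :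
    ∃ p : E → E, LipschitzWith 2 p ∧ (∀ x, p x ∈ closedBall e r) ∧
      ∀ x ∈ closedBall e r, p x = x := by
  have hmax (x : E) : 0 < max r ‖x - e‖ := lt_max_of_lt_left hr
  refine ⟨fun x => e + (r / max r ‖x - e‖) • (x - e), ?_, fun x => ?_, fun x hx => ?_⟩
  · refine LipschitzWith.of_dist_le_mul fun x y => ?_
    set a := max r ‖x - e‖ with ha
    set b := max r ‖y - e‖ with hb
    have ha0 : 0 < a := hmax x
    have hb0 : 0 < b := hmax y
    -- One summand carries the change of the point, the other the change of the scaling factor; each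
    -- is at most `‖x - y‖`, hence the constant 2.
    have hsplit : (e + (r / a) • (x - e)) - (e + (r / b) • (y - e)) =
        (r / a) • (x - y) + (r / a * ((b - a) / b)) • (y - e) := by
      have h1 : r / b = r / a - r / a * ((b - a) / b) := by field_simp; ring
      rw [h1]
      module
    have hab : |b - a| ≤ ‖x - y‖ := by
      rw [ha, hb, max_comm r, max_comm r]
      refine (abs_max_sub_max_le_abs _ _ _).trans ((abs_norm_sub_norm_le _ _).trans ?_)
      rw [sub_sub_sub_cancel_right, norm_sub_rev]
    have hra : r / a ≤ 1 := (div_le_one ha0).2 (le_max_left _ _)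
    have hra0 : 0 ≤ r / a := by positivity
    have hyb : ‖y - e‖ / b ≤ 1 := (div_le_one hb0).2 (le_max_right _ _)
    rw [dist_eq_norm, dist_eq_norm, hsplit]
    refine (norm_add_le _ _).trans ?_
    rw [norm_smul, norm_smul, Real.norm_eq_abs, Real.norm_eq_abs, abs_mul, abs_div (b - a),
      abs_of_pos hb0, abs_of_nonneg hra0]
    have h2 : r / a * (|b - a| / b) * ‖y - e‖ = (r / a) * |b - a| * (‖y - e‖ / b) := by ring
    rw [h2]
    have h3 : (r / a) * |b - a| * (‖y - e‖ / b) ≤ 1 * ‖x - y‖ * 1 := by gcongr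
    have h4 : r / a * ‖x - y‖ ≤ 1 * ‖x - y‖ := by gcongr
    push_cast
    linarith
  · rw [mem_closedBall, dist_eq_norm, add_sub_cancel_left, norm_smul, Real.norm_eq_abs,
      abs_of_pos (div_pos hr (hmax x)), div_mul_eq_mul_div, div_le_iff₀ (hmax x)]
    gcongr
    exact le_max_right _ _
  · rw [mem_closedBall, dist_eq_norm] at hx
    simp [max_eq_left hx, div_self hr.ne']

/-- A nonnegative function that satisfies `φ' ≤ -a φ` wherever it is below a level decays
exponentially once it starts below this level. -/
theorem le_mul_exp_of_hasDerivWithinAt_le_below {φ φ' : ℝ → ℝ} {a c t₁ : ℝ} (ha : 0 < a)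
    (hφ : ContinuousOn φ (Icc 0 t₁))
    (hφ' : ∀ t ∈ Ico 0 t₁, HasDerivWithinAt φ (φ' t) (Ici t) t)
    (hdec : ∀ t ∈ Ico 0 t₁, φ t < c → φ' t ≤ -a * φ t) (h0 : 0 ≤ φ 0) (h0c : φ 0 < c) :
    ∀ t ∈ Icc 0 t₁, φ t ≤ φ 0 * Real.exp (-(a / 2) * t) := by
  -- Comparison with an exponential of half the rate: where the curves touch, `-a φ < -(a / 2) φ` is
  -- the required strict inequality. It needs `φ > 0`, which `ε` guarantees even if `φ 0 = 0`.
  have hε : ∀ ε, 0 < ε → φ 0 + ε < c → ∀ t ∈ Icc 0 t₁,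
      φ t ≤ (φ 0 + ε) * Real.exp (-(a / 2) * t) := by
    intro ε hε hεc
    have hB (t : ℝ) : HasDerivAt (fun t => (φ 0 + ε) * Real.exp (-(a / 2) * t))
        ((φ 0 + ε) * (Real.exp (-(a / 2) * t) * -(a / 2))) t := by
      refine HasDerivAt.const_mul _ (HasDerivAt.exp ?_)
      simpa only [id, mul_one] using (hasDerivAt_id t).const_mul (-(a / 2))
    refine image_le_of_deriv_right_lt_deriv_boundary hφ hφ' (by simp [hε.le]) hB ?_
    intro t ht hEq
    have hpos : 0 < (φ 0 + ε) * Real.exp (-(a / 2) * t) := by positivity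
    have hle : Real.exp (-(a / 2) * t) ≤ 1 := Real.exp_le_one_iff.2 (by nlinarith [ht.1])
    have hlt : φ t < c := by rw [hEq]; nlinarith
    have := hdec t ht hlt
    nlinarith
  intro t ht
  have hlim : Filter.Tendsto (fun ε => (φ 0 + ε) * Real.exp (-(a / 2) * t)) (𝓝[>] 0)
      (𝓝 ((φ 0 + 0) * Real.exp (-(a / 2) * t))) := by
    refine Filter.Tendsto.mono_left (Continuous.tendsto ?_ _) nhdsWithin_le_nhds
    fun_prop
  rw [add_zero] at hlim
  refine ge_of_tendsto hlim ?_
  filter_upwards [self_mem_nhdsWithin, nhdsWithin_le_nhds (Iio_mem_nhds (sub_pos.2 h0c))]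
    with ε h1 h2
  exact hε ε h1 (by linarith [mem_Iio.1 h2]) t ht

/-- A Lyapunov criterion for differential-algebraic systems whose algebraic equation is solved near
the equilibrium by a Lipschitz function `h` of the differential variable. The Lyapunov function `V`
has at `x` the directional derivatives `V' x`. -/
theorem isLocallyExponentiallyStable_of_lyapunov {X Y : Type*} [NormedAddCommGroup X]
    [NormedSpace ℝ X] [CompleteSpace X] [NormedAddCommGroup Y] {f : X → Y → X} {S : Set (X × Y)}
    {xe : X} {h : X → Y} {V : X → ℝ} {V' : X → X → ℝ} {r m M a : ℝ} {K K' : ℝ≥0}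
    (hr : 0 < r) (hm : 0 < m) (hM : 0 < M) (ha : 0 < a)
    (hS : ∀ x y, ‖x - xe‖ ≤ r → ((x, y) ∈ S ↔ y = h x))
    (hh : LipschitzOnWith K h (closedBall xe r))
    (hf : LipschitzOnWith K' (fun x => f x (h x)) (closedBall xe r))
    (hV : ∀ (x : ℝ → X) (x' : X) (s : Set ℝ) (t : ℝ), HasDerivWithinAt x x' s t →
      HasDerivWithinAt (fun t => V (x t)) (V' (x t) x') s t)
    (hlow : ∀ x, m * ‖x - xe‖ ^ 2 ≤ V x) (hup : ∀ x, V x ≤ M * ‖x - xe‖ ^ 2)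
    (hdec : ∀ x, ‖x - xe‖ ≤ r → V' x (f x (h x)) ≤ -a * ‖x - xe‖ ^ 2) :
    IsLocallyExponentiallyStable f S xe (h xe) := by
  -- Starting within `r / R` forces `V < m * r ^ 2`, a sublevel set that lies inside the ball of
  -- radius `r`.
  set R := √(M / m) + 1 with hR
  have hR1 : 1 ≤ R := by linarith [Real.sqrt_nonneg (M / m)]
  have hRsq : M ≤ m * R ^ 2 := by
    have h1 : √(M / m) ^ 2 = M / m := Real.sq_sqrt (by positivity)
    have h2 : m * (M / m) = M := by field_simp
    nlinarith [Real.sqrt_nonneg (M / m)]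
  have hrR : r / R ≤ r := div_le_self hr.le hR1
  have hbelow (x : X) (hx : V x < m * r ^ 2) : ‖x - xe‖ < r := by
    have := (hlow x).trans_lt hx
    exact lt_of_pow_lt_pow_left₀ 2 hr.le (lt_of_mul_lt_mul_left this hm.le)
  have hstart (x : X) (hx : ‖x - xe‖ < r / R) : V x < m * r ^ 2 := by
    have h1 : R * ‖x - xe‖ < r := by rwa [lt_div_iff₀ (by positivity), mul_comm] at hx
    have h2 : (R * ‖x - xe‖) ^ 2 < r ^ 2 := by gcongr
    calc V x ≤ M * ‖x - xe‖ ^ 2 := hup x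
      _ ≤ m * R ^ 2 * ‖x - xe‖ ^ 2 := by gcongr
      _ = m * (R * ‖x - xe‖) ^ 2 := by ring
      _ < m * r ^ 2 := by gcongr
  have hxe : xe ∈ closedBall xe r := mem_closedBall_self hr.le
  have hhb (x : X) (hx : ‖x - xe‖ ≤ r) : ‖h x - h xe‖ ≤ K * ‖x - xe‖ := by
    have := hh.dist_le_mul x (by rwa [mem_closedBall, dist_eq_norm]) xe hxe
    rwa [dist_eq_norm, dist_eq_norm] at this
  have hVdec (x : X) (hx : ‖x - xe‖ ≤ r) : V' x (f x (h x)) ≤ -(a / M) * V x := by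
    refine (hdec x hx).trans ?_
    have h1 : a / M * V x ≤ a / M * (M * ‖x - xe‖ ^ 2) := by gcongr; exact hup x
    have h2 : a / M * (M * ‖x - xe‖ ^ 2) = a * ‖x - xe‖ ^ 2 := by field_simp
    linarith
  -- any curve that follows the field while it is in the ball stays there and decays
  have hdecay (t₁ : ℝ) (x x' : ℝ → X)
      (hg : ∀ t ∈ Icc 0 t₁, ‖x t - xe‖ ≤ r → x' t = f (x t) (h (x t)))
      (hx : ∀ t ∈ Icc 0 t₁, HasDerivWithinAt x (x' t) (Icc 0 t₁) t)
      (hx0 : ‖x 0 - xe‖ < r / R) : ∀ t ∈ Icc 0 t₁,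
        V (x t) < m * r ^ 2 ∧ V (x t) ≤ V (x 0) * Real.exp (-(a / M / 2) * t) := by
    intro t ht
    have hV0 : 0 ≤ V (x 0) := le_trans (by positivity) (hlow _)
    have hle := le_mul_exp_of_hasDerivWithinAt_le_below (φ := fun t => V (x t))
      (φ' := fun t => V' (x t) (x' t)) (a := a / M) (c := m * r ^ 2) (by positivity)
      (fun t ht => (hV x _ _ t (hx t ht)).continuousWithinAt)
      (fun t ht => (hV x _ _ t (hx t ⟨ht.1, ht.2.le⟩)).mono_of_mem_nhdsWithin
        (Filter.mem_of_superset (Icc_mem_nhdsGE ht.2) (Icc_subset_Icc_left ht.1)))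
      (fun t ht hlt => by
        have hb := (hbelow _ hlt).le
        simpa only [hg t ⟨ht.1, ht.2.le⟩ hb] using hVdec _ hb)
      hV0 (hstart _ hx0) t ht
    refine ⟨?_, hle⟩
    have hexp : Real.exp (-(a / M / 2) * t) ≤ 1 := by
      refine Real.exp_le_one_iff.2 ?_
      have : 0 ≤ a / M / 2 * t := mul_nonneg (by positivity) ht.1
      linarith
    exact (hle.trans (mul_le_of_le_one_right hV0 hexp)).trans_lt (hstart _ hx0)
  -- `V` decays at rate `a / M`, halved by the comparison lemma; passing from `V` to the norm halves
  -- it again. The factor `1 + K` accounts for the algebraic variable.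
  refine ⟨r / R, by positivity, (1 + K) * R, by positivity, a / M / 4, by positivity, ?_, ?_, ?_⟩
  · intro x₀ hx₀
    have hx₀r := hx₀.le.trans hrR
    refine ⟨h x₀, (hS _ _ hx₀r).2 rfl, (hhb x₀ hx₀r).trans ?_⟩
    have : (K : ℝ) ≤ (1 + K) * R := by nlinarith [K.coe_nonneg]
    gcongr
  · intro x₀ y₀ hxy hlt
    have hx₀ : ‖x₀ - xe‖ < r / R := lt_of_le_of_lt (norm_fst_le ((x₀, y₀) - (xe, h xe))) hlt
    -- Nothing is known of `f` and `h` outside the ball. Composing with the retraction gives a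
    -- bounded, globally Lipschitz field; its trajectory never leaves the ball, so it solves the
    -- original system.
    obtain ⟨p, hpl, hpb, hpe⟩ := exists_lipschitzWith_retraction_closedBall xe hr
    set g : X → X := fun x => f (p x) (h (p x)) with hgdef
    have hg (x : X) (hx : ‖x - xe‖ ≤ r) : g x = f x (h x) := by
      rw [hgdef]; simp only; rw [hpe x (by rwa [mem_closedBall, dist_eq_norm])]
    have hgl : LipschitzWith (K' * 2) g := by
      refine LipschitzWith.of_dist_le_mul fun x y => ?_
      refine (hf.dist_le_mul _ (hpb x) _ (hpb y)).trans ?_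
      have := hpl.dist_le_mul x y
      push_cast at this ⊢
      nlinarith [K'.coe_nonneg]
    have hgb (x : X) : ‖g x‖ ≤ (K' * r.toNNReal + ‖f xe (h xe)‖₊ : ℝ≥0) := by
      have h1 := hf.dist_le_mul _ (hpb x) _ hxe
      have h2 : dist (p x) xe ≤ r := hpb x
      rw [dist_eq_norm] at h1
      have h3 := norm_le_norm_sub_add (g x) (f xe (h xe))
      have h4 : (K' : ℝ) * dist (p x) xe ≤ K' * r := by gcongr
      push_cast
      rw [Real.coe_toNNReal _ hr.le]
      exact h3.trans (add_le_add_left (h1.trans h4) _)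
    obtain ⟨x, hx0, hx⟩ := exists_forall_hasDerivWithinAt_Ici_of_lipschitzWith hgl hgb x₀
    have hin (t : ℝ) (ht : 0 ≤ t) : ‖x t - xe‖ < r :=
      hbelow _ (hdecay t x (fun t => g (x t)) (fun s _ hs => hg _ hs)
        (fun s hs => (hx s hs.1).mono Icc_subset_Ici_self)
        (by rwa [hx0]) t ⟨ht, le_rfl⟩).1
    refine ⟨x, fun t => h (x t), ⟨?_, fun t ht => ⟨(hS _ _ (hin t ht).le).2 rfl, ?_⟩⟩, hx0, ?_⟩
    · refine hh.continuousOn.comp (fun t ht => (hx t ht).continuousWithinAt) fun t ht => ?_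
      rw [mem_closedBall, dist_eq_norm]
      exact (hin t ht).le
    · simpa only [hg _ (hin t ht).le] using hx t ht
    · simp only [hx0]
      exact ((hS _ _ (hx₀.le.trans hrR)).1 hxy).symm
  · intro t₁ ht₁ x y hsol hlt t ht
    have hx₀ : ‖x 0 - xe‖ < r / R :=
      lt_of_le_of_lt (norm_fst_le ((x 0, y 0) - (xe, h xe))) hlt
    have hyx (s : ℝ) (hs : s ∈ Icc 0 t₁) (hb : ‖x s - xe‖ ≤ r) : y s = h (x s) :=
      (hS _ _ hb).1 (hsol.2 s hs).1
    have hd := hdecay t₁ x (fun s => f (x s) (y s)) (fun s hs hb => by simp only [hyx s hs hb])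
      (fun s hs => (hsol.2 s hs).2) hx₀ t ht
    have hb := hbelow _ hd.1
    set q := Real.exp (-(a / M / 4) * t) with hq
    have hq2 : Real.exp (-(a / M / 2) * t) = q ^ 2 := by
      rw [hq, ← Real.exp_nat_mul]
      ring_nf
    have hq0 : 0 < q := Real.exp_pos _
    have hxt : ‖x t - xe‖ ≤ R * q * ‖x 0 - xe‖ := by
      refine le_of_sq_le_sq ?_ (by positivity)
      refine le_of_mul_le_mul_left ?_ hm
      calc m * ‖x t - xe‖ ^ 2 ≤ V (x t) := hlow _
        _ ≤ V (x 0) * q ^ 2 := hq2 ▸ hd.2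
        _ ≤ M * ‖x 0 - xe‖ ^ 2 * q ^ 2 := by gcongr; exact hup _
        _ ≤ m * R ^ 2 * ‖x 0 - xe‖ ^ 2 * q ^ 2 := by gcongr
        _ = m * (R * q * ‖x 0 - xe‖) ^ 2 := by ring
    have hfst : ‖x 0 - xe‖ ≤ ‖(x 0, y 0) - (xe, h xe)‖ := norm_fst_le ((x 0, y 0) - (xe, h xe))
    rw [hyx t ht hb.le]
    have hK : (0 : ℝ) ≤ K := K.coe_nonneg
    calc ‖(x t, h (x t)) - (xe, h xe)‖ = max ‖x t - xe‖ ‖h (x t) - h xe‖ := rfl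
      _ ≤ (1 + K) * ‖x t - xe‖ := by
        refine max_le ?_ ((hhb _ hb.le).trans ?_) <;> nlinarith [norm_nonneg (x t - xe)]
      _ ≤ (1 + K) * (R * q * ‖x 0 - xe‖) := by gcongr
      _ = (1 + K) * R * q * ‖x 0 - xe‖ := by ring
      _ ≤ (1 + K) * R * q * ‖(x 0, y 0) - (xe, h xe)‖ := by gcongr

end ODE

/-! ### Comparison of sup norms and sums of squares. -/

section FiniteFamilies

variable {ι κ : Type*} [Fintype ι] [Fintype κ]

theorem sum_sq_le_card_mul_norm_sq (x : ι → ℝ) : ∑ i, x i ^ 2 ≤ Fintype.card ι * ‖x‖ ^ 2 := by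
  calc ∑ i, x i ^ 2 ≤ ∑ _i : ι, ‖x‖ ^ 2 := by
        refine Finset.sum_le_sum fun i _ => ?_
        rw [← sq_abs (x i), ← Real.norm_eq_abs]
        gcongr
        exact norm_le_pi_norm x i
    _ = _ := by simp

theorem norm_sq_le_sum_sq (x : ι → ℝ) : ‖x‖ ^ 2 ≤ ∑ i, x i ^ 2 := by
  refine Real.le_sqrt (norm_nonneg x) (by positivity) |>.1 ?_
  refine (pi_norm_le_iff_of_nonneg (Real.sqrt_nonneg _)).2 fun i => ?_
  rw [Real.norm_eq_abs]
  exact Real.abs_le_sqrt (Finset.single_le_sum (fun j _ => sq_nonneg (x j)) (Finset.mem_univ i))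

theorem abs_sum_mul_le_card_mul_norm_mul_norm (x y : ι → ℝ) :
    |∑ i, x i * y i| ≤ Fintype.card ι * (‖x‖ * ‖y‖) := by
  refine (Finset.abs_sum_le_sum_abs _ _).trans ?_
  calc ∑ i, |x i * y i| ≤ ∑ _i : ι, ‖x‖ * ‖y‖ := by
        refine Finset.sum_le_sum fun i _ => ?_
        rw [abs_mul, ← Real.norm_eq_abs, ← Real.norm_eq_abs]
        gcongr
        exacts [norm_le_pi_norm x i, norm_le_pi_norm y i]
    _ = _ := by simp

theorem exists_pos_forall_le_of_forall_pos {ι : Type*} [Finite ι] {c : ι → ℝ} (hc : ∀ i, 0 < c i) :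
    ∃ m > (0 : ℝ), ∀ i, m ≤ c i := by
  rcases isEmpty_or_nonempty ι with h | h
  · exact ⟨1, one_pos, fun i => isEmptyElim i⟩
  · obtain ⟨j, hj⟩ := Finite.exists_min c
    exact ⟨c j, hc j, hj⟩

theorem exists_norm_mulVec_le (A : Matrix κ ι ℝ) :
    ∃ C > (0 : ℝ), ∀ x : ι → ℝ, ‖A *ᵥ x‖ ≤ C * ‖x‖ := by
  refine ⟨‖LinearMap.toContinuousLinearMap A.mulVecLin‖ + 1, by positivity, fun x => ?_⟩
  refine ((LinearMap.toContinuousLinearMap A.mulVecLin).le_opNorm x).trans ?_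
  gcongr
  linarith

theorem sum_mul_sq_le_of_norm_le (α y : ι → ℝ) {R : ℝ} (hy : ‖y‖ ≤ R) :
    ∑ i, α i * y i ^ 2 ≤ Fintype.card ι * ‖α‖ * R ^ 2 := by
  calc ∑ i, α i * y i ^ 2 ≤ ∑ _i : ι, ‖α‖ * R ^ 2 := by
        refine Finset.sum_le_sum fun i _ => ?_
        rw [← sq_abs (y i), ← Real.norm_eq_abs (y i)]
        have h1 : α i ≤ ‖α‖ := (le_abs_self _).trans (norm_le_pi_norm α i)
        have h2 : ‖y i‖ ≤ R := (norm_le_pi_norm y i).trans hy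
        gcongr
    _ = _ := by simp [mul_assoc]

/-- A sum of squares with positive weights is equivalent to the square of the norm. -/
theorem exists_weighted_sum_sq_bounds {α : ι → ℝ} {β : κ → ℝ} (hα : ∀ i, 0 < α i)
    (hβ : ∀ i, 0 < β i) : ∃ m > (0 : ℝ), ∃ M > (0 : ℝ), ∀ x : (ι → ℝ) × (κ → ℝ),
      m * ‖x‖ ^ 2 ≤ ∑ i, α i * x.1 i ^ 2 + ∑ i, β i * x.2 i ^ 2 ∧
      ∑ i, α i * x.1 i ^ 2 + ∑ i, β i * x.2 i ^ 2 ≤ M * ‖x‖ ^ 2 := by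
  obtain ⟨m₁, hm₁, h₁⟩ := exists_pos_forall_le_of_forall_pos hα
  obtain ⟨m₂, hm₂, h₂⟩ := exists_pos_forall_le_of_forall_pos hβ
  refine ⟨min m₁ m₂, lt_min hm₁ hm₂, Fintype.card ι * ‖α‖ + Fintype.card κ * ‖β‖ + 1,
    by positivity, fun x => ⟨?_, ?_⟩⟩
  · have h3 : min m₁ m₂ * ‖x.1‖ ^ 2 ≤ ∑ i, α i * x.1 i ^ 2 := by
      refine (mul_le_mul_of_nonneg_left (norm_sq_le_sum_sq _) (lt_min hm₁ hm₂).le).trans ?_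
      rw [Finset.mul_sum]
      gcongr with i
      exact (min_le_left _ _).trans (h₁ i)
    have h4 : min m₁ m₂ * ‖x.2‖ ^ 2 ≤ ∑ i, β i * x.2 i ^ 2 := by
      refine (mul_le_mul_of_nonneg_left (norm_sq_le_sum_sq _) (lt_min hm₁ hm₂).le).trans ?_
      rw [Finset.mul_sum]
      gcongr with i
      exact (min_le_right _ _).trans (h₂ i)
    have h5 : 0 ≤ min m₁ m₂ * ‖x.1‖ ^ 2 := by positivity
    have h6 : 0 ≤ min m₁ m₂ * ‖x.2‖ ^ 2 := by positivity
    rcases max_choice ‖x.1‖ ‖x.2‖ with h | h <;> rw [Prod.norm_def, h] <;> linarith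
  · have h1 := sum_mul_sq_le_of_norm_le α x.1 (norm_fst_le x)
    have h2 := sum_mul_sq_le_of_norm_le β x.2 (norm_snd_le x)
    nlinarith [sq_nonneg ‖x‖]

end FiniteFamilies

namespace Microgrid

/-! ### Definiteness, invertibility and positivity for the network matrices. -/

section Network

variable {L I : Type*}

theorem b_nonpos (N : Microgrid L I) (i j : L ⊕ I) : N.b i j ≤ 0 := by
  by_cases h : N.graph.Adj i j
  · exact (N.b_neg i j h).le
  · exact (N.b_zero i j h).le

theorem b_self (N : Microgrid L I) (i : L ⊕ I) : N.b i i = 0 :=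
  N.b_zero i i (N.graph.loopless.irrefl i)

/-- A set of buses that contains the neighbours of its members contains all buses. -/
theorem forall_of_forall_adj (N : Microgrid L I) {p : L ⊕ I → Prop} {i : L ⊕ I} (hi : p i)
    (hp : ∀ j k, N.graph.Adj j k → p j → p k) (k : L ⊕ I) : p k := by
  obtain ⟨w⟩ := N.connected.preconnected i k
  induction w with
  | nil => exact hi
  | cons h _ ih => exact ih (hp _ _ h hi)

variable [Fintype L] [Fintype I] [DecidableEq L] [DecidableEq I] (N : Microgrid L I)

theorem B_mulVec (x : L ⊕ I → ℝ) (i : L ⊕ I) : (N.B *ᵥ x) i = ∑ j, N.b i j * (x i - x j) := by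
  have hB (j : L ⊕ I) : N.B i j = (if i = j then ∑ k, N.b i k else 0) - N.b i j := by
    by_cases h : i = j
    · subst h
      simp [B, b_self]
    · simp [B, h]
  simp only [mulVec, dotProduct, hB, sub_mul, ite_mul, zero_mul, Finset.sum_sub_distrib, mul_sub,
    Finset.sum_ite_eq, Finset.mem_univ, if_true, Finset.sum_mul]

/-- Averaging the sum with its copy under exchange of the two indices completes the squares, by
symmetry of `b`. -/
theorem sum_mul_B_mulVec (x : L ⊕ I → ℝ) :
    ∑ i, x i * (N.B *ᵥ x) i = (∑ i, ∑ j, N.b i j * (x i - x j) ^ 2) / 2 := by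
  have h1 : ∑ i, x i * (N.B *ᵥ x) i = ∑ i, ∑ j, N.b i j * (x i * (x i - x j)) := by
    refine Finset.sum_congr rfl fun i _ => ?_
    rw [B_mulVec, Finset.mul_sum]
    exact Finset.sum_congr rfl fun j _ => by ring
  have h2 : ∑ i, x i * (N.B *ᵥ x) i = ∑ i, ∑ j, N.b i j * (x j * (x j - x i)) := by
    rw [h1, Finset.sum_comm]
    exact Finset.sum_congr rfl fun j _ => Finset.sum_congr rfl fun i _ => by rw [N.b_symm]
  rw [eq_div_iff two_ne_zero, mul_two]
  nth_rw 1 [h1]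
  rw [h2, ← Finset.sum_add_distrib]
  refine Finset.sum_congr rfl fun i _ => ?_
  rw [← Finset.sum_add_distrib]
  exact Finset.sum_congr rfl fun j _ => by ring

/-- The quadratic form of `B + diag (0, K_I)`. -/
def quadForm (x : L ⊕ I → ℝ) : ℝ := ∑ i, x i * (N.B *ᵥ x) i + ∑ i, N.K i * x (Sum.inr i) ^ 2

/-- Both sums have nonpositive terms. If the total vanishes, `x` is zero at an inverter, because `K
< 0`, and equal along every branch, so connectedness makes it zero everywhere. -/
theorem quadForm_neg [Nonempty I] {x : L ⊕ I → ℝ} (hx : x ≠ 0) : N.quadForm x < 0 := by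
  have hterm (i j) : N.b i j * (x i - x j) ^ 2 ≤ 0 :=
    mul_nonpos_of_nonpos_of_nonneg (N.b_nonpos i j) (sq_nonneg _)
  have hKterm (i) : N.K i * x (Sum.inr i) ^ 2 ≤ 0 :=
    mul_nonpos_of_nonpos_of_nonneg (N.K_neg i).le (sq_nonneg _)
  have hB : ∑ i, ∑ j, N.b i j * (x i - x j) ^ 2 ≤ 0 :=
    Finset.sum_nonpos fun i _ => Finset.sum_nonpos fun j _ => hterm i j
  have hK : ∑ i, N.K i * x (Sum.inr i) ^ 2 ≤ 0 := Finset.sum_nonpos fun i _ => hKterm i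
  by_contra! hge
  rw [quadForm, sum_mul_B_mulVec] at hge
  have hB0 : ∑ i, ∑ j, N.b i j * (x i - x j) ^ 2 = 0 := by linarith
  have hK0 : ∑ i, N.K i * x (Sum.inr i) ^ 2 = 0 := by linarith
  have hK' := (Finset.sum_eq_zero_iff_of_nonpos fun i _ => hKterm i).1 hK0
  have hB' := (Finset.sum_eq_zero_iff_of_nonpos
    fun i _ => Finset.sum_nonpos fun j _ => hterm i j).1 hB0
  obtain ⟨k⟩ := ‹Nonempty I›
  have hk : x (Sum.inr k) = 0 := by
    have := hK' k (Finset.mem_univ _)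
    simpa [(N.K_neg k).ne] using this
  refine hx (funext fun i => N.forall_of_forall_adj (p := fun i => x i = 0) hk ?_ i)
  intro i j hij hi
  have := (Finset.sum_eq_zero_iff_of_nonpos fun j _ => hterm i j).1
    (hB' i (Finset.mem_univ _)) j (Finset.mem_univ _)
  have h2 : x i - x j = 0 := by simpa [(N.b_neg i j hij).ne] using this
  linarith

theorem quadForm_smul (a : ℝ) (x : L ⊕ I → ℝ) : N.quadForm (a • x) = a ^ 2 * N.quadForm x := by
  simp only [quadForm, mulVec_smul, Pi.smul_apply, smul_eq_mul, mul_add, Finset.mul_sum]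
  congr 1 <;> exact Finset.sum_congr rfl fun i _ => by ring

/-- The matrix `B + diag (0, K_I)` is negative definite. -/
theorem exists_quadForm_le [Nonempty I] :
    ∃ l > (0 : ℝ), ∀ x : L ⊕ I → ℝ, N.quadForm x ≤ -l * ∑ i, x i ^ 2 := by
  have hcont : Continuous N.quadForm := by
    unfold quadForm mulVec dotProduct
    fun_prop
  have hne : (Metric.sphere (0 : L ⊕ I → ℝ) 1).Nonempty := NormedSpace.sphere_nonempty.2 zero_le_one
  obtain ⟨z, hz, hmax⟩ := (isCompact_sphere (0 : L ⊕ I → ℝ) 1).exists_isMaxOn hne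
    hcont.continuousOn
  have hz0 : z ≠ 0 := fun h => by simp [h] at hz
  have hneg := N.quadForm_neg hz0
  have hcard : (0 : ℝ) < Fintype.card (L ⊕ I) := by exact_mod_cast Fintype.card_pos
  -- Homogeneity extends the maximum over the unit sphere of the sup norm to all `x`; the number of
  -- buses converts the sup norm into the sum of squares.
  refine ⟨-N.quadForm z / Fintype.card (L ⊕ I), div_pos (by linarith) hcard, fun x => ?_⟩
  have hhom : N.quadForm x ≤ N.quadForm z * ‖x‖ ^ 2 := by
    by_cases hx : x = 0
    · simp [hx, quadForm]
    · have hnx : 0 < ‖x‖ := norm_pos_iff.2 hx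
      have h1 : N.quadForm (‖x‖⁻¹ • x) ≤ N.quadForm z := hmax (by simp [norm_smul, hnx.ne'])
      rw [quadForm_smul] at h1
      calc N.quadForm x = (‖x‖⁻¹ ^ 2 * N.quadForm x) * ‖x‖ ^ 2 := by field_simp
        _ ≤ _ := by gcongr
  calc N.quadForm x ≤ N.quadForm z * ‖x‖ ^ 2 := hhom
    _ = -(-N.quadForm z / Fintype.card (L ⊕ I)) * (Fintype.card (L ⊕ I) * ‖x‖ ^ 2) := by
      field_simp
    _ ≤ _ := by
      refine mul_le_mul_of_nonpos_left (sum_sq_le_card_mul_norm_sq x) ?_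
      have : 0 < -N.quadForm z / Fintype.card (L ⊕ I) := div_pos (by linarith) hcard
      linarith

/-- Minimum principle: if `x` satisfies the inverter equations `(B x)_I + K_I (x_I - E_I^*) = 0` and
each load bus has a positive voltage or is in balance, then all voltages are positive. -/
theorem pos_of_inverter_balance [Nonempty I] {x : L ⊕ I → ℝ}
    (hI : ∀ i, (N.B *ᵥ x) (Sum.inr i) + N.K i * (x (Sum.inr i) - N.Estar i) = 0)
    (hL : ∀ i, 0 < x (Sum.inl i) ∨ (N.B *ᵥ x) (Sum.inl i) = 0) (i : L ⊕ I) : 0 < x i := by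
  have : Nonempty (L ⊕ I) := ⟨i⟩
  obtain ⟨j, hj⟩ := Finite.exists_min x
  refine lt_of_lt_of_le ?_ (hj i)
  -- At an inverter with minimal `x ≤ 0`, `(B x)_i ≥ 0` and `K (x - E^*) > 0` cannot add up to zero.
  -- A load at the minimum is in balance, so its neighbours share the minimum, which spreads along
  -- the graph to an inverter.
  by_contra! hj0
  have hterm (k l : L ⊕ I) (hk : x k = x j) : 0 ≤ N.b k l * (x k - x l) :=
    mul_nonneg_of_nonpos_of_nonpos (N.b_nonpos k l) (by linarith [hj l])
  have hinr (k : I) : x (Sum.inr k) ≠ x j := by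
    intro hk
    have h1 : 0 ≤ (N.B *ᵥ x) (Sum.inr k) := by
      rw [B_mulVec]
      exact Finset.sum_nonneg fun l _ => hterm _ l hk
    have h2 := mul_pos_of_neg_of_neg (N.K_neg k)
      (by linarith [N.Estar_pos k] : x (Sum.inr k) - N.Estar k < 0)
    linarith [hI k]
  obtain ⟨k⟩ := ‹Nonempty I›
  refine hinr k (N.forall_of_forall_adj (p := fun k => x k = x j) rfl ?_ _)
  rintro (k | k) l hkl hk
  · have hzero := (hL k).resolve_left (by linarith)
    rw [B_mulVec, Finset.sum_eq_zero_iff_of_nonneg fun l _ => hterm _ l hk] at hzero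
    have := hzero l (Finset.mem_univ _)
    have : x (Sum.inl k) - x l = 0 := by simpa [(N.b_neg _ _ hkl).ne] using this
    linarith
  · exact absurd hk (hinr k)

theorem B_mulVec_inl (y : L → ℝ) (u : I → ℝ) (i : L) :
    (N.B *ᵥ Sum.elim y u) (Sum.inl i) =
      (N.B.toBlocks₁₁ *ᵥ y) i + (N.B.toBlocks₁₂ *ᵥ u) i := by
  conv_lhs => rw [← fromBlocks_toBlocks N.B, fromBlocks_mulVec]
  simp

theorem B_mulVec_inr (y : L → ℝ) (u : I → ℝ) (i : I) :
    (N.B *ᵥ Sum.elim y u) (Sum.inr i) =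
      (N.B.toBlocks₂₁ *ᵥ y) i + (N.B.toBlocks₂₂ *ᵥ u) i := by
  conv_lhs => rw [← fromBlocks_toBlocks N.B, fromBlocks_mulVec]
  simp

theorem eq_zero_of_quadForm_nonneg [Nonempty I] {y : L → ℝ} {u : I → ℝ}
    (h : 0 ≤ N.quadForm (Sum.elim y u)) : y = 0 ∧ u = 0 := by
  by_contra hne
  refine absurd (N.quadForm_neg (x := Sum.elim y u) fun h0 => hne ⟨?_, ?_⟩) h.not_gt
  · funext i; simpa using congrFun h0 (Sum.inl i)
  · funext i; simpa using congrFun h0 (Sum.inr i)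

theorem quadForm_elim (y : L → ℝ) (u : I → ℝ) :
    N.quadForm (Sum.elim y u) = ∑ i, y i * (N.B *ᵥ Sum.elim y u) (Sum.inl i) +
      ∑ i, u i * ((N.B *ᵥ Sum.elim y u) (Sum.inr i) + N.K i * u i) := by
  rw [quadForm, Fintype.sum_sum_type, add_assoc, ← Finset.sum_add_distrib]
  congr 1
  exact Finset.sum_congr rfl fun i _ => by simp only [Sum.elim_inr]; ring

omit [Fintype L] [DecidableEq L] in
theorem KI_mulVec (u : I → ℝ) (i : I) : (N.KI *ᵥ u) i = N.K i * u i := by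
  rw [KI, mulVec_diagonal]

theorem isUnit_BII_add_KI [Nonempty I] : IsUnit (N.B.toBlocks₂₂ + N.KI) := by
  rw [← mulVec_injective_iff_isUnit, ← coe_mulVecLin, ← LinearMap.ker_eq_bot,
    LinearMap.ker_eq_bot']
  intro u hu
  refine (N.eq_zero_of_quadForm_nonneg (y := 0) ?_).2
  rw [quadForm_elim]
  refine add_nonneg (by simp) (Finset.sum_nonneg fun i _ => ?_)
  have := congrFun hu i
  rw [mulVecLin_apply, add_mulVec, Pi.add_apply, KI_mulVec, Pi.zero_apply] at this
  rw [B_mulVec_inr]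
  simp [this]

/-- The inverter voltages that solve the inverter equations, in terms of the blocks of `B`. -/
theorem inverterVoltages_eq (EL : L → ℝ) : N.inverterVoltages EL =
    (N.B.toBlocks₂₂ + N.KI)⁻¹ *ᵥ (N.KI *ᵥ N.Estar - N.B.toBlocks₂₁ *ᵥ EL) := by
  rw [inverterVoltages, W₂, ← mulVec_mulVec, fromCols_mulVec_sumElim, neg_mulVec, neg_add_eq_sub]

theorem eq_inverterVoltages_iff [Nonempty I] (EL : L → ℝ) (EI : I → ℝ) :
    EI = N.inverterVoltages EL ↔
      ∀ i, (N.B *ᵥ Sum.elim EL EI) (Sum.inr i) + N.K i * (EI i - N.Estar i) = 0 := by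
  have hdet := (isUnit_iff_isUnit_det _).1 N.isUnit_BII_add_KI
  have hiff : EI = N.inverterVoltages EL ↔
      (N.B.toBlocks₂₂ + N.KI) *ᵥ EI = N.KI *ᵥ N.Estar - N.B.toBlocks₂₁ *ᵥ EL := by
    rw [inverterVoltages_eq]
    constructor
    · rintro rfl
      rw [mulVec_mulVec, mul_nonsing_inv _ hdet, one_mulVec]
    · intro h
      rw [← h, mulVec_mulVec, nonsing_inv_mul _ hdet, one_mulVec]
  rw [hiff, funext_iff]
  refine forall_congr' fun i => ?_
  rw [B_mulVec_inr, add_mulVec, Pi.add_apply, Pi.sub_apply, KI_mulVec, KI_mulVec]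
  constructor <;> intro h <;> linarith

theorem Bred_mulVec (y : L → ℝ) (i : L) : (N.Bred *ᵥ y) i = (N.B *ᵥ Sum.elim y
    (-((N.B.toBlocks₂₂ + N.KI)⁻¹ *ᵥ (N.B.toBlocks₂₁ *ᵥ y)))) (Sum.inl i) := by
  rw [B_mulVec_inl, Bred, sub_mulVec, ← mulVec_mulVec, ← mulVec_mulVec, mulVec_neg]
  simp [sub_eq_add_neg]

/-- A kernel vector `y`, extended to the inverters by the `u` that solves the homogeneous inverter
equations, makes the quadratic form vanish. -/
theorem isUnit_Bred [Nonempty I] : IsUnit N.Bred := by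
  have hdet := (isUnit_iff_isUnit_det _).1 N.isUnit_BII_add_KI
  rw [← mulVec_injective_iff_isUnit, ← coe_mulVecLin, ← LinearMap.ker_eq_bot,
    LinearMap.ker_eq_bot']
  intro y hy
  set u := -((N.B.toBlocks₂₂ + N.KI)⁻¹ *ᵥ (N.B.toBlocks₂₁ *ᵥ y)) with hu
  refine (N.eq_zero_of_quadForm_nonneg (u := u) (le_of_eq ?_)).1
  have h1 (i : L) : (N.B *ᵥ Sum.elim y u) (Sum.inl i) = 0 := by
    rw [← Bred_mulVec]
    exact congrFun hy i
  have h2 (i : I) : (N.B *ᵥ Sum.elim y u) (Sum.inr i) + N.K i * u i = 0 := by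
    have h3 : (N.B.toBlocks₂₂ + N.KI) *ᵥ u = -(N.B.toBlocks₂₁ *ᵥ y) := by
      rw [hu, mulVec_neg, mulVec_mulVec, mul_nonsing_inv _ hdet, one_mulVec]
    have := congrFun h3 i
    rw [add_mulVec, Pi.add_apply, KI_mulVec, Pi.neg_apply] at this
    rw [B_mulVec_inr]
    linarith
  rw [quadForm_elim]
  simp [h1, h2]

theorem Bred_mulVec_ELstar [Nonempty I] : N.Bred *ᵥ N.ELstar =
    -(N.B.toBlocks₁₂ *ᵥ ((N.B.toBlocks₂₂ + N.KI)⁻¹ *ᵥ (N.KI *ᵥ N.Estar))) := by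
  have hdet := (isUnit_iff_isUnit_det _).1 N.isUnit_Bred
  rw [ELstar, W₁, neg_mulVec, mulVec_neg, ← mulVec_mulVec, ← mulVec_mulVec, ← mulVec_mulVec,
    mulVec_mulVec _ N.Bred, mul_nonsing_inv _ hdet, one_mulVec]

/-- Eliminating the inverter voltages turns `B` into `B_red`. -/
theorem B_mulVec_inverterVoltages [Nonempty I] (EL : L → ℝ) (i : L) :
    (N.B *ᵥ Sum.elim EL (N.inverterVoltages EL)) (Sum.inl i) =
      (N.Bred *ᵥ (EL - N.ELstar)) i := by
  rw [mulVec_sub, Pi.sub_apply, Bred_mulVec_ELstar, Bred_mulVec, B_mulVec_inl, B_mulVec_inl,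
    inverterVoltages_eq, mulVec_sub, mulVec_sub, mulVec_neg]
  simp only [Pi.sub_apply, Pi.neg_apply]
  ring

/-- In the open-circuit profile every load is in balance, so the minimum principle applies. -/
theorem ELstar_pos [Nonempty I] (i : L) : 0 < N.ELstar i := by
  have h := N.pos_of_inverter_balance (x := Sum.elim N.ELstar (N.inverterVoltages N.ELstar))
    ((N.eq_inverterVoltages_iff _ _).1 rfl)
    (fun i => Or.inr (by rw [B_mulVec_inverterVoltages]; simp)) (Sum.inl i)
  simpa using h

theorem inverterVoltages_pos [Nonempty I] {EL : L → ℝ} (hEL : ∀ i, 0 < EL i) (i : I) :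
    0 < N.inverterVoltages EL i := by
  have h := N.pos_of_inverter_balance (x := Sum.elim EL (N.inverterVoltages EL))
    ((N.eq_inverterVoltages_iff _ _).1 rfl) (fun i => Or.inl (by simpa using hEL i)) (Sum.inr i)
  simpa using h

theorem isUnit_Qsc [Nonempty I] : IsUnit N.Qsc := by
  have hd : IsUnit (diagonal N.ELstar) := by
    rw [isUnit_diagonal, Pi.isUnit_iff]
    exact fun i => (N.ELstar_pos i).ne'.isUnit
  exact (hd.mul N.isUnit_Bred).mul hd

end Network

end Microgrid

/-! ### The reduced power flow equation as a fixed-point problem. -/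

/-- The map `v ↦ Q / (1 + v)` is Lipschitz where `1 + v` is bounded below. -/
theorem norm_div_one_add_sub_le {ι : Type*} [Fintype ι] {q v w : ι → ℝ} {c : ℝ} (hc : 0 < c)
    (hv : ∀ i, c ≤ 1 + v i) (hw : ∀ i, c ≤ 1 + w i) :
    ‖(fun i => q i / (1 + v i)) - fun i => q i / (1 + w i)‖ ≤ ‖q‖ / c ^ 2 * ‖v - w‖ := by
  refine (pi_norm_le_iff_of_nonneg (by positivity)).2 fun i => ?_
  have h1 : 0 < 1 + v i := hc.trans_le (hv i)
  have h2 : 0 < 1 + w i := hc.trans_le (hw i)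
  have h3 : q i / (1 + v i) - q i / (1 + w i) =
      -(q i / ((1 + v i) * (1 + w i)) * (v i - w i)) := by field_simp; ring
  have h4 : c ^ 2 ≤ (1 + v i) * (1 + w i) := by
    rw [sq]
    exact mul_le_mul (hv i) (hw i) hc.le h1.le
  rw [Pi.sub_apply, h3, norm_neg, norm_mul, norm_div, Real.norm_of_nonneg (by positivity :
    0 ≤ (1 + v i) * (1 + w i))]
  gcongr
  exacts [norm_le_pi_norm q i, norm_le_pi_norm (v - w) i]

namespace Microgrid

section PowerFlow

variable {L I : Type*} [Fintype L] [Fintype I] [DecidableEq L] [DecidableEq I] (N : Microgrid L I)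

theorem Qsc_mulVec (v : L → ℝ) (i : L) :
    (N.Qsc *ᵥ v) i = N.ELstar i * (N.Bred *ᵥ fun j => N.ELstar j * v j) i := by
  rw [Qsc, ← mulVec_mulVec, ← mulVec_mulVec, mulVec_diagonal]
  congr 2
  funext j
  rw [mulVec_diagonal]

/-- The reduced power flow equation in terms of the relative deviation `v` of the load voltages. -/
theorem isReducedSolution_iff [Nonempty I] {QL b v : L → ℝ} (hv : ∀ i, 0 < 1 + v i) :
    N.IsReducedSolution QL (fun i => N.ELstar i * (1 + v i)) b ↔
      v = -(N.Qsc⁻¹ *ᵥ fun i => QL i / (1 + v i)) ∧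
        b = fun i => QL i / (N.ELstar i * (1 + v i)) ^ 2 := by
  have hdet := (isUnit_iff_isUnit_det _).1 N.isUnit_Qsc
  have hdev : (fun i => N.ELstar i * (1 + v i)) - N.ELstar = fun i => N.ELstar i * v i := by
    funext i
    simp only [Pi.sub_apply]
    ring
  have hfix : v = -(N.Qsc⁻¹ *ᵥ fun i => QL i / (1 + v i)) ↔
      N.Qsc *ᵥ v = -fun i => QL i / (1 + v i) := by
    constructor
    · intro h
      conv_lhs => rw [h]
      rw [mulVec_neg, mulVec_mulVec, mul_nonsing_inv _ hdet, one_mulVec]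
    · intro h
      rw [← mulVec_neg, ← h, mulVec_mulVec, nonsing_inv_mul _ hdet, one_mulVec]
  have hb : (∀ i, 0 = QL i - (N.ELstar i * (1 + v i)) ^ 2 * b i) ↔
      b = fun i => QL i / (N.ELstar i * (1 + v i)) ^ 2 := by
    rw [funext_iff]
    refine forall_congr' fun i => ?_
    have : (N.ELstar i * (1 + v i)) ^ 2 ≠ 0 :=
      pow_ne_zero _ (mul_pos (N.ELstar_pos i) (hv i)).ne'
    rw [eq_div_iff this]
    constructor <;> intro h <;> linarith
  rw [IsReducedSolution, hb, hfix, hdev]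
  refine and_congr_left fun hbi => ?_
  rw [funext_iff]
  refine forall_congr' fun i => ?_
  have hi := (hv i).ne'
  have hE := (N.ELstar_pos i).ne'
  rw [Pi.neg_apply, Qsc_mulVec, shuntLoad, hbi]
  simp only
  rw [div_mul_cancel₀ _ (pow_ne_zero _ (mul_ne_zero hE hi)), ← neg_div, eq_div_iff hi]
  constructor <;> intro h <;> linarith

/-- Existence, uniqueness and first-order expansion of the high-voltage solution of the reduced
power flow equation for small demands. -/
theorem exists_unique_highVoltage_solution [Nonempty I] :
    ∃ C > (0 : ℝ), ∀ c : ℝ, 0 < c → c < 1 → ∃ δ > (0 : ℝ),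
      ∀ QL : L → ℝ, (∀ i, QL i < 0) → ‖QL‖ < δ →
        ∃ EL b : L → ℝ,
          ((∀ i, 0 < EL i) ∧ (∀ i, b i < 0) ∧ (∀ i, c * N.ELstar i < EL i) ∧
            N.IsReducedSolution QL EL b) ∧
          (∀ EL' b' : L → ℝ, (∀ i, 0 < EL' i) → (∀ i, b' i < 0) →
            (∀ i, c * N.ELstar i < EL' i) → N.IsReducedSolution QL EL' b' →
            EL' = EL ∧ b' = b) ∧
          (∃ ε : L → ℝ, EL = diagonal N.ELstar *ᵥ (1 - N.Qsc⁻¹ *ᵥ QL + ε) ∧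
            ‖ε‖ ≤ C * ‖N.Qsc⁻¹ *ᵥ QL‖ ^ 2) ∧
          (b = fun i => QL i / EL i ^ 2) ∧ ∀ i, N.ELstar i / 2 ≤ EL i := by
  obtain ⟨P, hP, hPle⟩ := exists_norm_mulVec_le N.Qsc⁻¹
  obtain ⟨D, hD, hDle⟩ := exists_norm_mulVec_le N.Qsc
  have hdet := (isUnit_iff_isUnit_det _).1 N.isUnit_Qsc
  -- Two uses of `1 + v ≥ 1 / 2` give the 4. This constant precedes `c`, so the lower bound on `1 +
  -- v` must not depend on `c`.
  refine ⟨4 * P ^ 2 * D ^ 2, by positivity, fun c hc0 hc1 => ?_⟩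
  -- Then `1 - ρ = (1 + c) / 2` exceeds both `c` and `1 / 2`.
  set ρ := (1 - c) / 2 with hρ
  have hρ0 : 0 < ρ := by linarith
  -- This bound makes `P * ‖QL‖ / c ^ 2 < ρ < 1 / 2`, which serves both the contraction constant and
  -- the self-map property.
  refine ⟨ρ * c ^ 2 / P, by positivity, fun QL hneg hQL => ?_⟩
  have hPQ : P * (‖QL‖ / c ^ 2) < ρ := by
    rw [lt_div_iff₀ hP] at hQL
    rw [← mul_div_assoc, div_lt_iff₀ (by positivity)]
    linarith
  set G : (L → ℝ) → L → ℝ := fun v => -(N.Qsc⁻¹ *ᵥ fun i => QL i / (1 + v i)) with hG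
  have hlip (v w : L → ℝ) (hv : ∀ i, c ≤ 1 + v i) (hw : ∀ i, c ≤ 1 + w i) :
      ‖G v - G w‖ ≤ 1 / 2 * ‖v - w‖ := by
    have h1 : G v - G w =
        -(N.Qsc⁻¹ *ᵥ ((fun i => QL i / (1 + v i)) - fun i => QL i / (1 + w i))) := by
      rw [mulVec_sub, hG, neg_sub]
      exact neg_sub_neg _ _
    rw [h1, norm_neg]
    calc _ ≤ P * (‖QL‖ / c ^ 2 * ‖v - w‖) :=
          (hPle _).trans (by gcongr; exact norm_div_one_add_sub_le hc0 hv hw)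
      _ = P * (‖QL‖ / c ^ 2) * ‖v - w‖ := by ring
      _ ≤ 1 / 2 * ‖v - w‖ := by gcongr; linarith
  have hball (v : L → ℝ) (hv : v ∈ Metric.closedBall (0 : L → ℝ) ρ) (i : L) : 1 - ρ ≤ 1 + v i := by
    rw [mem_closedBall_zero_iff] at hv
    have := (norm_le_pi_norm v i).trans hv
    rw [Real.norm_eq_abs] at this
    linarith [neg_abs_le (v i)]
  have hdiv (v : L → ℝ) (q : ℝ) (hq : 0 < q) (hv : ∀ i, q ≤ 1 + v i) (Q : L → ℝ) :
      ‖fun i => Q i / (1 + v i)‖ ≤ ‖Q‖ / q := by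
    refine (pi_norm_le_iff_of_nonneg (by positivity)).2 fun i => ?_
    have : 0 < 1 + v i := hq.trans_le (hv i)
    rw [norm_div, Real.norm_of_nonneg this.le]
    gcongr
    exacts [norm_le_pi_norm Q i, hv i]
  have hmaps : Set.MapsTo G (Metric.closedBall 0 ρ) (Metric.closedBall 0 ρ) := by
    intro v hv
    rw [mem_closedBall_zero_iff, hG, norm_neg]
    have h1 := hdiv v c hc0 (fun i => by linarith [hball v hv i]) QL
    have h2 : ‖QL‖ / c ≤ ‖QL‖ / c ^ 2 := by
      gcongr
      nlinarith
    calc _ ≤ P * (‖QL‖ / c ^ 2) := (hPle _).trans (by gcongr; exact h1.trans h2)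
      _ ≤ ρ := hPQ.le
  have hcontr : ContractingWith (1 / 2) (hmaps.restrict G _ _) := by
    refine ⟨by norm_num [← NNReal.coe_lt_coe], LipschitzWith.of_dist_le_mul fun v w => ?_⟩
    rw [Subtype.dist_eq, Subtype.dist_eq, dist_eq_norm, dist_eq_norm]
    have := hlip v w (fun i => by linarith [hball v v.2 i]) (fun i => by linarith [hball w w.2 i])
    simpa using this
  obtain ⟨v, hvball, hvfix, -⟩ := hcontr.exists_fixedPoint' Metric.isClosed_closedBall.isComplete
    hmaps (Metric.mem_closedBall_self hρ0.le) (edist_ne_top _ _)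
  have hvfix : v = G v := hvfix.symm
  have hv1 (i : L) : 1 / 2 ≤ 1 + v i := by linarith [hball v hvball i]
  have hvc (i : L) : c < 1 + v i := by linarith [hball v hvball i]
  have hEpos (i : L) : 0 < N.ELstar i * (1 + v i) :=
    mul_pos (N.ELstar_pos i) (by linarith [hv1 i])
  refine ⟨fun i => N.ELstar i * (1 + v i), fun i => QL i / (N.ELstar i * (1 + v i)) ^ 2,
    ⟨hEpos, fun i => div_neg_of_neg_of_pos (hneg i) (pow_pos (hEpos i) 2), fun i => ?_, ?_⟩, ?_, ?_,
    rfl, fun i => ?_⟩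
  · rw [mul_comm]
    exact mul_lt_mul_of_pos_left (hvc i) (N.ELstar_pos i)
  · exact (N.isReducedSolution_iff fun i => by linarith [hv1 i]).2 ⟨hvfix, rfl⟩
  · intro EL' b' _ _ hhigh hsol
    obtain ⟨w, rfl⟩ : ∃ w : L → ℝ, EL' = fun i => N.ELstar i * (1 + w i) := by
      refine ⟨fun i => EL' i / N.ELstar i - 1, funext fun i => ?_⟩
      have := (N.ELstar_pos i).ne'
      field_simp
      ring
    have hwc (i : L) : c < 1 + w i := by
      have := hhigh i
      rw [mul_comm] at this
      exact lt_of_mul_lt_mul_left this (N.ELstar_pos i).le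
    obtain ⟨hw, hb'⟩ := (N.isReducedSolution_iff fun i => hc0.trans (hwc i)).1 hsol
    -- The competitor `w` may lie outside the ball; `hlip` only needs `c ≤ 1 + w`.
    have hdist := hlip w v (fun i => (hwc i).le) (fun i => (hvc i).le)
    have hw' : G w = w := hw.symm
    rw [← hvfix, hw'] at hdist
    have hwv : w = v := by
      rw [← sub_eq_zero, ← norm_le_zero_iff]
      linarith
    subst hwv
    exact ⟨rfl, hb'⟩
  · refine ⟨v + N.Qsc⁻¹ *ᵥ QL, funext fun i => ?_, ?_⟩
    · rw [mulVec_diagonal]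
      simp
    · have hε : v + N.Qsc⁻¹ *ᵥ QL = N.Qsc⁻¹ *ᵥ fun i => QL i * v i / (1 + v i) := by
        nth_rw 1 [hvfix]
        rw [hG, neg_add_eq_sub, ← mulVec_sub]
        congr 1
        funext i
        have : 1 + v i ≠ 0 := by linarith [hv1 i]
        rw [Pi.sub_apply]
        field_simp
        ring
      have hQD : ‖QL‖ ≤ D * ‖N.Qsc⁻¹ *ᵥ QL‖ := by
        refine le_of_eq_of_le ?_ (hDle _)
        rw [mulVec_mulVec, mul_nonsing_inv _ hdet, one_mulVec]
      have hvQ : ‖v‖ ≤ P * (‖QL‖ / (1 / 2)) := by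
        rw [hvfix, hG, norm_neg]
        exact (hPle _).trans (by gcongr; exact hdiv v _ (by norm_num) hv1 QL)
      have hQv : ‖fun i => QL i * v i‖ ≤ ‖QL‖ * ‖v‖ := norm_mul_le QL v
      rw [hε]
      calc _ ≤ P * (‖fun i => QL i * v i‖ / (1 / 2)) :=
            (hPle _).trans (by gcongr; exact hdiv v _ (by norm_num) hv1 _)
        _ ≤ P * (‖QL‖ * (P * (‖QL‖ / (1 / 2))) / (1 / 2)) := by
            gcongr
            exact hQv.trans (by gcongr)
        _ = 4 * P ^ 2 * ‖QL‖ ^ 2 := by ring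
        _ ≤ 4 * P ^ 2 * (D * ‖N.Qsc⁻¹ *ᵥ QL‖) ^ 2 := by gcongr
        _ = _ := by ring
  · rw [div_eq_mul_one_div]
    exact mul_le_mul_of_nonneg_left (hv1 i) (N.ELstar_pos i).le

end PowerFlow

end Microgrid

/-! ### The Lyapunov function and its dissipation. -/

theorem hasDerivWithinAt_weighted_sum_sq {ι κ : Type*} [Fintype ι] [Fintype κ]
    (α : ι → ℝ) (β : κ → ℝ) (e : (ι → ℝ) × (κ → ℝ))
    {x : ℝ → (ι → ℝ) × (κ → ℝ)} {x' : (ι → ℝ) × (κ → ℝ)} {s : Set ℝ} {t : ℝ}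
    (hx : HasDerivWithinAt x x' s t) :
    HasDerivWithinAt (fun t => ∑ i, α i * (x t - e).1 i ^ 2 + ∑ i, β i * (x t - e).2 i ^ 2)
      (∑ i, α i * (2 * (x t - e).1 i * x'.1 i) + ∑ i, β i * (2 * (x t - e).2 i * x'.2 i)) s t := by
  have h1 (i : ι) : HasDerivWithinAt (fun t => (x t - e).1 i) (x'.1 i) s t :=
    (hasDerivWithinAt_pi.1 hx.fst i).sub_const (e.1 i)
  have h2 (i : κ) : HasDerivWithinAt (fun t => (x t - e).2 i) (x'.2 i) s t :=
    (hasDerivWithinAt_pi.1 hx.snd i).sub_const (e.2 i)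
  refine HasDerivWithinAt.add (HasDerivWithinAt.fun_sum fun i _ => ?_)
    (HasDerivWithinAt.fun_sum fun i _ => ?_)
  · simpa using ((h1 i).pow 2).const_mul (α i)
  · simpa using ((h2 i).pow 2).const_mul (β i)

/-- The pointwise estimate behind the decay of the Lyapunov function at a load bus: `y` and `w` are
the deviations of the voltage `Y` and of the shunt susceptance from their equilibrium values. -/
theorem load_dissipation_le {l b Y Z y w : ℝ} (hl : 0 < l) (hb : -(l / 6) ≤ b) (hb0 : b ≤ 0)
    (hZ : 0 < Z) (hZY : Z ≤ 2 * Y) :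
    -l * y ^ 2 + b * y ^ 2 + Y * y * w - 1 / l * (Y ^ 2 * w ^ 2 + b * (Y + Z) * y * w) ≤
      -(1 / (4 * l)) * (Y ^ 2 * w ^ 2) := by
  have hY : 0 < Y := by linarith
  set p := |y| * (Y * |w|) with hp
  have h1 : Y * y * w ≤ p := by
    have := le_abs_self (Y * y * w)
    rw [abs_mul, abs_mul, abs_of_pos hY] at this
    linarith
  have h2 : -(b * (Y + Z) * y * w) ≤ l / 2 * p := by
    have h3 := neg_abs_le (b * (Y + Z) * y * w)
    rw [abs_mul, abs_mul, abs_mul, abs_of_nonpos hb0, abs_of_pos (by linarith : 0 < Y + Z)] at h3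
    have h4 : -b * (Y + Z) * |y| * |w| ≤ l / 6 * (3 * Y) * |y| * |w| := by
      gcongr
      · linarith
      · linarith
    have h5 : l / 6 * (3 * Y) * |y| * |w| = l / 2 * p := by rw [hp]; ring
    linarith
  have h3 : b * y ^ 2 ≤ 0 := mul_nonpos_of_nonpos_of_nonneg hb0 (sq_nonneg y)
  have h4 : -(1 / l) * (b * (Y + Z) * y * w) ≤ p / 2 := by
    have : 1 / l * -(b * (Y + Z) * y * w) ≤ 1 / l * (l / 2 * p) := by gcongr
    have h5 : 1 / l * (l / 2 * p) = p / 2 := by field_simp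
    linarith
  -- The cross terms total `p + p / 2`. Three quarters of the dissipation in `w` suffice to absorb
  -- them; one quarter remains.
  have h5 : 0 ≤ l * y ^ 2 - 3 / 2 * p + 3 / (4 * l) * (Y ^ 2 * w ^ 2) := by
    have h6 : l * y ^ 2 - 3 / 2 * p + 3 / (4 * l) * (Y ^ 2 * w ^ 2) =
        1 / l * (3 / 4 * (l * |y| - Y * |w|) ^ 2 + 1 / 4 * l ^ 2 * y ^ 2) := by
      rw [hp, ← sq_abs y, ← sq_abs w]
      field_simp
      ring
    rw [h6]
    positivity
  have h6 : 3 / (4 * l) * (Y ^ 2 * w ^ 2) =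
      1 / l * (Y ^ 2 * w ^ 2) - 1 / (4 * l) * (Y ^ 2 * w ^ 2) := by
    field_simp
    ring
  linarith

namespace Microgrid

section Stability

variable {L I : Type*} [Fintype L] [Fintype I] [DecidableEq L] [DecidableEq I] (N : Microgrid L I)

/-- The load voltages that satisfy the algebraic equation at the differential state `(E_I, b)`. -/
noncomputable def loadVoltages (x : (I → ℝ) × (L → ℝ)) : L → ℝ :=
  -((N.B.toBlocks₁₁ + diagonal x.2)⁻¹ *ᵥ (N.B.toBlocks₁₂ *ᵥ x.1))

theorem sum_mul_BLL_mulVec (y : L → ℝ) :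
    ∑ i, y i * (N.B.toBlocks₁₁ *ᵥ y) i = N.quadForm (Sum.elim y 0) := by
  rw [quadForm_elim]
  simp [B_mulVec_inl]

/-- Since `b ≤ 0`, adding `diagonal b` keeps the negative definite block `B_LL` negative definite.
-/
theorem eq_loadVoltages_iff [Nonempty I] {y : L → ℝ} {u : I → ℝ} {b : L → ℝ}
    (hb : ∀ i, b i ≤ 0) : y = N.loadVoltages (u, b) ↔
      ∀ i, b i * y i + (N.B *ᵥ Sum.elim y u) (Sum.inl i) = 0 := by
  have hunit : IsUnit (N.B.toBlocks₁₁ + diagonal b) := by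
    rw [← mulVec_injective_iff_isUnit, ← coe_mulVecLin, ← LinearMap.ker_eq_bot,
      LinearMap.ker_eq_bot']
    intro y hy
    refine (N.eq_zero_of_quadForm_nonneg (u := 0) ?_).1
    rw [← sum_mul_BLL_mulVec]
    refine Finset.sum_nonneg fun i _ => ?_
    have := congrFun hy i
    rw [mulVecLin_apply, add_mulVec, Pi.add_apply, mulVec_diagonal, Pi.zero_apply] at this
    have h2 : (N.B.toBlocks₁₁ *ᵥ y) i = -b i * y i := by linarith
    rw [h2]
    nlinarith [hb i, sq_nonneg (y i)]
  have hdet := (isUnit_iff_isUnit_det _).1 hunit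
  have hiff : y = N.loadVoltages (u, b) ↔
      (N.B.toBlocks₁₁ + diagonal b) *ᵥ y = -(N.B.toBlocks₁₂ *ᵥ u) := by
    rw [loadVoltages, ← mulVec_neg]
    constructor
    · rintro rfl
      rw [mulVec_mulVec, mul_nonsing_inv _ hdet, one_mulVec]
    · intro h
      simp only
      rw [← h, mulVec_mulVec, nonsing_inv_mul _ hdet, one_mulVec]
  rw [hiff, funext_iff]
  refine forall_congr' fun i => ?_
  rw [B_mulVec_inl, add_mulVec, Pi.add_apply, mulVec_diagonal, Pi.neg_apply]
  constructor <;> intro h <;> linarith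

/-- Lipschitz dependence of the load voltages on the differential variables. -/
theorem norm_sub_le_of_load_balance {l C : ℝ} (hl0 : 0 < l)
    (hl : ∀ x : L ⊕ I → ℝ, N.quadForm x ≤ -l * ∑ i, x i ^ 2)
    (hC : ∀ u : I → ℝ, ‖N.B.toBlocks₁₂ *ᵥ u‖ ≤ C * ‖u‖) {y₁ y₂ b₁ b₂ : L → ℝ} {u₁ u₂ : I → ℝ}
    (hb : ∀ i, b₁ i ≤ 0)
    (h₁ : ∀ i, b₁ i * y₁ i + (N.B *ᵥ Sum.elim y₁ u₁) (Sum.inl i) = 0)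
    (h₂ : ∀ i, b₂ i * y₂ i + (N.B *ᵥ Sum.elim y₂ u₂) (Sum.inl i) = 0) :
    ‖y₁ - y₂‖ ≤ Fintype.card L / l * (C * ‖u₁ - u₂‖ + ‖b₁ - b₂‖ * ‖y₂‖) := by
  set d := y₁ - y₂ with hd
  set g : L → ℝ := N.B.toBlocks₁₂ *ᵥ (u₁ - u₂) + (b₁ - b₂) * y₂ with hg
  have hgn : ‖g‖ ≤ C * ‖u₁ - u₂‖ + ‖b₁ - b₂‖ * ‖y₂‖ :=
    (norm_add_le _ _).trans (add_le_add (hC _) (norm_mul_le _ _))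
  -- The difference of the two balances is linear in `d` with source `g`; testing it with `d` and
  -- using definiteness bounds `d` by `g`.
  have heq (i : L) : (N.B.toBlocks₁₁ *ᵥ d) i = -(b₁ i * d i) - g i := by
    have e₁ := h₁ i
    have e₂ := h₂ i
    rw [B_mulVec_inl] at e₁ e₂
    simp only [hd, hg, mulVec_sub, Pi.sub_apply, Pi.add_apply, Pi.mul_apply]
    linarith
  have h3 : ∑ i, d i * (N.B.toBlocks₁₁ *ᵥ d) i ≤ -l * ∑ i, d i ^ 2 := by
    have := hl (Sum.elim d 0)
    rw [← sum_mul_BLL_mulVec, Fintype.sum_sum_type] at this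
    simpa using this
  have h4 : -∑ i, d i * g i ≤ ∑ i, d i * (N.B.toBlocks₁₁ *ᵥ d) i := by
    rw [← Finset.sum_neg_distrib]
    refine Finset.sum_le_sum fun i _ => ?_
    rw [heq]
    nlinarith [hb i, sq_nonneg (d i)]
  have h5 := abs_sum_mul_le_card_mul_norm_mul_norm d g
  have h6 := (mul_le_mul_of_nonneg_left (norm_sq_le_sum_sq d) hl0.le)
  have h7 : l * ‖d‖ ^ 2 ≤ Fintype.card L * (‖d‖ * ‖g‖) := by
    linarith [le_abs_self (∑ i, d i * g i)]
  have h8 : ‖d‖ ≤ Fintype.card L / l * ‖g‖ := by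
    rcases (norm_nonneg d).eq_or_lt with h | h
    · rw [← h]
      positivity
    · rw [div_mul_eq_mul_div, le_div_iff₀ hl0]
      refine le_of_mul_le_mul_right ?_ h
      linarith
  exact h8.trans (by gcongr)

theorem contDiff_vectorField (T QL : L → ℝ) : ContDiff ℝ 1
    fun z : ((I → ℝ) × (L → ℝ)) × (L → ℝ) => N.vectorField T QL z.1 z.2 := by
  unfold vectorField inverterRHS
  simp only [mulVec, dotProduct, Fintype.sum_sum_type, Sum.elim_inl, Sum.elim_inr]
  refine ContDiff.prodMk (contDiff_pi.2 fun i => ?_) (contDiff_pi.2 fun i => ?_) <;> fun_prop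

theorem loadBalance_eq_zero_iff {y b : L → ℝ} {u : I → ℝ} (hy : ∀ i, 0 < y i) :
    N.loadBalance y u b = 0 ↔ ∀ i, b i * y i + (N.B *ᵥ Sum.elim y u) (Sum.inl i) = 0 := by
  rw [funext_iff]
  refine forall_congr' fun i => ?_
  have h : N.loadBalance y u b i =
      y i * (b i * y i + (N.B *ᵥ Sum.elim y u) (Sum.inl i)) := by
    rw [loadBalance, shuntLoad]
    ring
  rw [h, Pi.zero_apply, mul_eq_zero, or_iff_right (hy i).ne']

/-- The inequality between the derivative of the Lyapunov function along the closed loop and the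
squares of the deviations. -/
theorem lyapunov_derivative_le {T QL : L → ℝ} (hT : ∀ i, 0 < T i) {l : ℝ} (hl0 : 0 < l)
    (hl : ∀ x : L ⊕ I → ℝ, N.quadForm x ≤ -l * ∑ i, x i ^ 2) {EL b Y : L → ℝ} {EI : I → ℝ}
    {x : (I → ℝ) × (L → ℝ)} (hEL : ∀ i, 0 < EL i) (hEI : ∀ i, 0 < EI i)
    (hb : ∀ i, -(l / 6) ≤ b i) (hb0 : ∀ i, b i ≤ 0)
    (heqI : ∀ i, (N.B *ᵥ Sum.elim EL EI) (Sum.inr i) + N.K i * (EI i - N.Estar i) = 0)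
    (heqL : ∀ i, b i * EL i + (N.B *ᵥ Sum.elim EL EI) (Sum.inl i) = 0)
    (hQ : ∀ i, QL i = EL i ^ 2 * b i)
    (hY : ∀ i, x.2 i * Y i + (N.B *ᵥ Sum.elim Y x.1) (Sum.inl i) = 0)
    (hYEL : ∀ i, EL i ≤ 2 * Y i)
    (hsmall : ∀ i, N.K i * (x.1 i - EI i) +
      (N.B *ᵥ Sum.elim (Y - EL) (x.1 - EI)) (Sum.inr i) ≤ l / 2 * EI i) :
    ∑ i, N.τ i / EI i * (2 * (x - (EI, b)).1 i * (N.vectorField T QL x Y).1 i) +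
      ∑ i, T i / l * (2 * (x - (EI, b)).2 i * (N.vectorField T QL x Y).2 i) ≤
      -(∑ i, l * (x - (EI, b)).1 i ^ 2 + ∑ i, EL i ^ 2 / (8 * l) * (x - (EI, b)).2 i ^ 2) := by
  set u := x.1 - EI with hu
  set w := x.2 - b with hw
  set y := Y - EL with hy
  have hlin : N.B *ᵥ Sum.elim Y x.1 = N.B *ᵥ Sum.elim EL EI + N.B *ᵥ Sum.elim y u := by
    rw [← mulVec_add]
    congr 1
    funext i
    rcases i with i | i <;> simp [hu, hy]
  set g : I → ℝ := fun i => (N.B *ᵥ Sum.elim y u) (Sum.inr i) + N.K i * u i with hg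
  have hinl (i : L) : (N.B *ᵥ Sum.elim y u) (Sum.inl i) = -(b i * y i + Y i * w i) := by
    have h1 := hY i
    have h2 := heqL i
    rw [hlin, Pi.add_apply] at h1
    simp only [hy, hw, Pi.sub_apply]
    linarith
  -- The weight `τ / EI` leaves `2 u g (1 + u / EI)`; by `hsmall` the excess costs at most half of
  -- the `2 l u²` gained from the quadratic form.
  have hinv (i : I) : N.τ i / EI i * (2 * u i * (N.vectorField T QL x Y).1 i) ≤
      2 * (u i * g i) + l * u i ^ 2 := by
    have h1 : (N.vectorField T QL x Y).1 i = (EI i + u i) * g i / N.τ i := by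
      have h2 := heqI i
      have h3 : (N.B *ᵥ Sum.elim EL EI) (Sum.inr i) = -(N.K i * (EI i - N.Estar i)) := by linarith
      simp only [vectorField, inverterRHS, hlin, Pi.add_apply, h3, hg, hu, Pi.sub_apply]
      ring
    have hτ := (N.τ_pos i).ne'
    have hE := (hEI i).ne'
    have h2 : N.τ i / EI i * (2 * u i * (N.vectorField T QL x Y).1 i) =
        2 * (u i * g i) + 2 * u i ^ 2 * (g i / EI i) := by
      rw [h1]
      field_simp
    have h3 : g i / EI i ≤ l / 2 := by
      rw [div_le_iff₀ (hEI i)]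
      have := hsmall i
      simp only [hg, hu, Pi.sub_apply]
      linarith
    have h4 : 2 * u i ^ 2 * (g i / EI i) ≤ 2 * u i ^ 2 * (l / 2) := by gcongr
    linarith
  -- Here `QL = EL² b` and `Y² - EL² = (Y + EL) y`.
  have hload (i : L) : T i / l * (2 * w i * (N.vectorField T QL x Y).2 i) =
      2 * -(1 / l * (Y i ^ 2 * w i ^ 2 + b i * (Y i + EL i) * y i * w i)) := by
    have hTi := (hT i).ne'
    simp only [vectorField, hQ, hw, hy, Pi.sub_apply]
    field_simp
    ring
  have hquad := hl (Sum.elim y u)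
  rw [quadForm_elim, Fintype.sum_sum_type] at hquad
  simp only [Sum.elim_inl, Sum.elim_inr, hinl] at hquad
  have hdiss : ∑ i, (-l * y i ^ 2 + b i * y i ^ 2 + Y i * y i * w i -
      1 / l * (Y i ^ 2 * w i ^ 2 + b i * (Y i + EL i) * y i * w i)) ≤
      ∑ i, -(EL i ^ 2 / (16 * l) * w i ^ 2) := by
    refine Finset.sum_le_sum fun i _ => ?_
    refine (load_dissipation_le hl0 (hb i) (hb0 i) (hEL i) (hYEL i)).trans ?_
    have h1 : EL i ^ 2 ≤ (2 * Y i) ^ 2 := by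
      have := (hEL i).le
      gcongr
      exact hYEL i
    have h2 : EL i ^ 2 / (16 * l) * w i ^ 2 ≤ (2 * Y i) ^ 2 / (16 * l) * w i ^ 2 := by gcongr
    have h3 : (2 * Y i) ^ 2 / (16 * l) * w i ^ 2 = 1 / (4 * l) * (Y i ^ 2 * w i ^ 2) := by
      field_simp
      ring
    linarith
  have hA : ∑ i, N.τ i / EI i * (2 * u i * (N.vectorField T QL x Y).1 i) ≤
      2 * ∑ i, u i * g i + l * ∑ i, u i ^ 2 := by
    rw [Finset.mul_sum, Finset.mul_sum, ← Finset.sum_add_distrib]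
    exact Finset.sum_le_sum fun i _ => hinv i
  have hB : ∑ i, T i / l * (2 * w i * (N.vectorField T QL x Y).2 i) =
      2 * -∑ i, 1 / l * (Y i ^ 2 * w i ^ 2 + b i * (Y i + EL i) * y i * w i) := by
    rw [← Finset.sum_neg_distrib, Finset.mul_sum]
    exact Finset.sum_congr rfl fun i _ => hload i
  have hC : ∑ i, y i * -(b i * y i + Y i * w i) =
      -∑ i, (b i * y i ^ 2 + Y i * y i * w i) := by
    rw [← Finset.sum_neg_distrib]
    exact Finset.sum_congr rfl fun i _ => by ring
  have hD : ∑ i, (-l * y i ^ 2 + b i * y i ^ 2 + Y i * y i * w i -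
      1 / l * (Y i ^ 2 * w i ^ 2 + b i * (Y i + EL i) * y i * w i)) =
      -l * ∑ i, y i ^ 2 + ∑ i, (b i * y i ^ 2 + Y i * y i * w i) -
      ∑ i, 1 / l * (Y i ^ 2 * w i ^ 2 + b i * (Y i + EL i) * y i * w i) := by
    rw [Finset.mul_sum, ← Finset.sum_add_distrib, ← Finset.sum_sub_distrib]
    exact Finset.sum_congr rfl fun i _ => by ring
  have hF : ∑ i, -(EL i ^ 2 / (16 * l) * w i ^ 2) =
      -(1 / 2) * ∑ i, EL i ^ 2 / (8 * l) * w i ^ 2 := by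
    rw [Finset.mul_sum]
    exact Finset.sum_congr rfl fun i _ => by field_simp; ring
  have hG : ∑ i, l * u i ^ 2 = l * ∑ i, u i ^ 2 := by rw [Finset.mul_sum]
  change ∑ i, N.τ i / EI i * (2 * u i * (N.vectorField T QL x Y).1 i) +
      ∑ i, T i / l * (2 * w i * (N.vectorField T QL x Y).2 i) ≤
      -(∑ i, l * u i ^ 2 + ∑ i, EL i ^ 2 / (8 * l) * w i ^ 2)
  rw [hC] at hquad
  rw [hD, hF] at hdiss
  rw [hB, hG]
  linarith

end Stability

end Microgrid

/-! ### Equilibria of the closed loop and their stability. -/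

theorem LipschitzOnWith.comp_graph {X Y Z : Type*} [PseudoEMetricSpace X] [PseudoEMetricSpace Y]
    [PseudoEMetricSpace Z] {F : X × Y → Z} {h : X → Y} {s : Set (X × Y)} {t : Set X}
    {K K' : NNReal} (hF : LipschitzOnWith K F s) (hh : LipschitzOnWith K' h t)
    (hst : ∀ x ∈ t, (x, h x) ∈ s) :
    LipschitzOnWith (K * max 1 K') (fun x => F (x, h x)) t :=
  hF.comp (LipschitzWith.id.lipschitzOnWith.prodMk hh) hst

namespace Microgrid

section Equilibrium

open scoped Topology

variable {L I : Type*} [Fintype L] [Fintype I] [DecidableEq L] [DecidableEq I] (N : Microgrid L I)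

theorem IsReducedSolution.load_balance [Nonempty I] {N : Microgrid L I} {QL EL b : L → ℝ}
    (h : N.IsReducedSolution QL EL b) (hEL : ∀ i, 0 < EL i) (i : L) :
    b i * EL i + (N.B *ᵥ Sum.elim EL (N.inverterVoltages EL)) (Sum.inl i) = 0 := by
  rw [B_mulVec_inverterVoltages]
  have h1 := h.1 i
  rw [shuntLoad] at h1
  refine (mul_eq_zero.1 ?_).resolve_left (hEL i).ne'
  linarith

theorem inverterRHS_eq (EL : L → ℝ) (EI : I → ℝ) (i : I) : N.inverterRHS EL EI i =
    EI i * ((N.B *ᵥ Sum.elim EL EI) (Sum.inr i) + N.K i * (EI i - N.Estar i)) := by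
  rw [inverterRHS]
  ring

/-- A solution of the reduced power flow equation belongs to exactly one equilibrium point. -/
theorem IsReducedSolution.isEquilibrium_iff [Nonempty I] {N : Microgrid L I} {T QL EL b : L → ℝ}
    (h : N.IsReducedSolution QL EL b) (hEL : ∀ i, 0 < EL i) (EI : I → ℝ) :
    N.IsEquilibrium T QL EL EI b ↔ EI = N.inverterVoltages EL := by
  constructor
  · rintro ⟨⟨-, hEI, -⟩, hfield⟩
    rw [eq_inverterVoltages_iff]
    intro i
    have h1 : N.inverterRHS EL EI i / N.τ i = 0 := congrFun (congrArg Prod.fst hfield) i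
    rw [inverterRHS_eq, div_eq_zero_iff, or_iff_left (N.τ_pos i).ne', mul_eq_zero,
      or_iff_right (hEI i).ne'] at h1
    exact h1
  · rintro rfl
    refine ⟨⟨hEL, N.inverterVoltages_pos hEL,
      (N.loadBalance_eq_zero_iff hEL).2 (h.load_balance hEL)⟩, Prod.ext ?_ ?_⟩
    · funext i
      have := (N.eq_inverterVoltages_iff EL _).1 rfl i
      simp only [vectorField, inverterRHS_eq, this, mul_zero, zero_div, Prod.fst_zero,
        Pi.zero_apply]
    · funext i
      simp only [vectorField, ← h.2 i, zero_div, Prod.snd_zero, Pi.zero_apply]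

/-- Equilibrium points with small shunt susceptances are locally exponentially stable. -/
theorem exists_isLocallyExponentiallyStable_of_small_susceptance [Nonempty I] {T : L → ℝ}
    (hT : ∀ i, 0 < T i) : ∃ β > (0 : ℝ), ∀ QL EL b : L → ℝ, (∀ i, 0 < EL i) → (∀ i, b i < 0) →
      (∀ i, -β ≤ b i) → N.IsReducedSolution QL EL b →
      IsLocallyExponentiallyStable (N.vectorField T QL) N.stateSet
        (N.inverterVoltages EL, b) EL := by
  obtain ⟨l, hl0, hl⟩ := N.exists_quadForm_le
  obtain ⟨C, hC0, hC⟩ := exists_norm_mulVec_le N.B.toBlocks₁₂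
  obtain ⟨D, hD0, hD⟩ := exists_norm_mulVec_le N.B
  -- The threshold of `load_dissipation_le`; `l` depends on the network alone, so the bound is
  -- uniform in the demands.
  refine ⟨l / 6, by positivity, fun QL EL b hEL hbneg hbβ hsol => ?_⟩
  set EI := N.inverterVoltages EL with hEIdef
  have hEI : ∀ i, 0 < EI i := N.inverterVoltages_pos hEL
  have heqI := (N.eq_inverterVoltages_iff EL EI).1 rfl
  have heqL := hsol.load_balance hEL
  have hQ (i : L) : QL i = EL i ^ 2 * b i := by linarith [hsol.2 i]
  have hye : N.loadVoltages (EI, b) = EL :=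
    ((N.eq_loadVoltages_iff fun i => (hbneg i).le).2 heqL).symm
  have hbal (x : (I → ℝ) × (L → ℝ)) (hx : ∀ i, x.2 i ≤ 0) :=
    (N.eq_loadVoltages_iff (y := N.loadVoltages x) (u := x.1) hx).1 rfl
  set n : ℝ := Fintype.card L / l with hn
  have hn0 : 0 ≤ n := by positivity
  set H := n * (C + ‖EL‖) with hH
  have hH0 : 0 ≤ H := by positivity
  have hdist (x : (I → ℝ) × (L → ℝ)) (hx : ∀ i, x.2 i ≤ 0) :
      ‖N.loadVoltages x - EL‖ ≤ H * ‖x - (EI, b)‖ := by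
    have h1 : ‖x.1 - EI‖ ≤ ‖x - (EI, b)‖ := norm_fst_le (x - (EI, b))
    have h2 : ‖x.2 - b‖ ≤ ‖x - (EI, b)‖ := norm_snd_le (x - (EI, b))
    calc _ ≤ n * (C * ‖x.1 - EI‖ + ‖x.2 - b‖ * ‖EL‖) :=
          N.norm_sub_le_of_load_balance hl0 hl hC hx (hbal x hx) heqL
      _ ≤ n * (C * ‖x - (EI, b)‖ + ‖x - (EI, b)‖ * ‖EL‖) := by gcongr
      _ = H * ‖x - (EI, b)‖ := by rw [hH]; ring
  obtain ⟨Kf, s, hs, hfs⟩ :=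
    (N.contDiff_vectorField T QL).contDiffAt.exists_lipschitzOnWith (x := ((EI, b), EL))
  obtain ⟨ρ, hρ0, hρ⟩ := Metric.mem_nhds_iff.1 hs
  -- a radius on which all the required inequalities hold
  have hev (p q : ℝ) (hq : 0 < q) : ∀ᶠ r in 𝓝[>] (0 : ℝ), p * r < q := by
    have : Filter.Tendsto (fun r : ℝ => p * r) (𝓝[>] 0) (𝓝 (p * 0)) :=
      Filter.Tendsto.mono_left (Continuous.tendsto (by fun_prop) _) nhdsWithin_le_nhds
    rw [mul_zero] at this
    exact this.eventually_lt_const hq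
  -- The bounds by `ρ` keep the graph of `loadVoltages` where the field is Lipschitz; those by `-b
  -- i` and `EI i` preserve signs; `H * r < EL i / 2` keeps load voltages above half their
  -- equilibrium values; the last yields `hsmall`.
  obtain ⟨r, hr0, hr1, hrρ, hrHρ, hrb, hrI, hrL, hrsmall⟩ : ∃ r > (0 : ℝ), 1 * r < 1 ∧
      1 * r < ρ ∧ H * r < ρ ∧ (∀ i, 1 * r < -b i) ∧ (∀ i, 1 * r < EI i) ∧
      (∀ i, H * r < EL i / 2) ∧ ∀ i, (|N.K i| + D * (H + 1)) * r < l / 2 * EI i := by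
    have h := (self_mem_nhdsWithin (a := (0 : ℝ)) (s := Set.Ioi 0))
    exact (Filter.Eventually.and h <| (hev 1 1 one_pos).and <| (hev 1 ρ hρ0).and <|
      (hev H ρ hρ0).and <| (Filter.eventually_all.2 fun i => hev 1 _ (neg_pos.2 (hbneg i))).and <|
      (Filter.eventually_all.2 fun i => hev 1 _ (hEI i)).and <|
      (Filter.eventually_all.2 fun i => hev H _ (half_pos (hEL i))).and <|
      Filter.eventually_all.2 fun i => hev _ _ (mul_pos (half_pos hl0) (hEI i))).exists
  simp only [one_mul] at hr1 hrρ hrb hrI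
  have hx2 (x : (I → ℝ) × (L → ℝ)) (hx : ‖x - (EI, b)‖ ≤ r) (i : L) : x.2 i ≤ 0 := by
    have h1 : |x.2 i - b i| ≤ r :=
      (norm_le_pi_norm (x - (EI, b)).2 i).trans ((norm_snd_le _).trans hx)
    linarith [le_abs_self (x.2 i - b i), hrb i]
  have hx1 (x : (I → ℝ) × (L → ℝ)) (hx : ‖x - (EI, b)‖ ≤ r) (i : I) : 0 < x.1 i := by
    have h1 : |x.1 i - EI i| ≤ r :=
      (norm_le_pi_norm (x - (EI, b)).1 i).trans ((norm_fst_le _).trans hx)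
    linarith [neg_abs_le (x.1 i - EI i), hrI i]
  have hxy (x : (I → ℝ) × (L → ℝ)) (hx : ‖x - (EI, b)‖ ≤ r) :
      ‖N.loadVoltages x - EL‖ ≤ H * r :=
    (hdist x (hx2 x hx)).trans (by gcongr)
  have hhalf (x : (I → ℝ) × (L → ℝ)) (hx : ‖x - (EI, b)‖ ≤ r) (i : L) :
      EL i / 2 < N.loadVoltages x i := by
    have h1 : |N.loadVoltages x i - EL i| ≤ H * r :=
      (norm_le_pi_norm (N.loadVoltages x - EL) i).trans (hxy x hx)
    linarith [neg_abs_le (N.loadVoltages x i - EL i), hrL i]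
  have hlip : LipschitzOnWith (n * (C + (‖EL‖ + H * r))).toNNReal N.loadVoltages
      (Metric.closedBall (EI, b) r) := by
    refine LipschitzOnWith.of_dist_le_mul fun x hx z hz => ?_
    rw [mem_closedBall_iff_norm] at hx hz
    rw [Real.coe_toNNReal _ (by positivity), dist_eq_norm, dist_eq_norm]
    have h1 : ‖x.1 - z.1‖ ≤ ‖x - z‖ := norm_fst_le (x - z)
    have h2 : ‖x.2 - z.2‖ ≤ ‖x - z‖ := norm_snd_le (x - z)
    have h3 : ‖N.loadVoltages z‖ ≤ ‖EL‖ + H * r := by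
      have := norm_le_norm_add_norm_sub' (N.loadVoltages z) EL
      rw [norm_sub_rev] at this
      linarith [hxy z hz, norm_sub_rev EL (N.loadVoltages z)]
    calc _ ≤ n * (C * ‖x.1 - z.1‖ + ‖x.2 - z.2‖ * ‖N.loadVoltages z‖) :=
          N.norm_sub_le_of_load_balance hl0 hl hC (hx2 x hx) (hbal x (hx2 x hx))
            (hbal z (hx2 z hz))
      _ ≤ n * (C * ‖x - z‖ + ‖x - z‖ * (‖EL‖ + H * r)) := by gcongr
      _ = _ := by ring
  have hflip : LipschitzOnWith (Kf * max 1 (n * (C + (‖EL‖ + H * r))).toNNReal)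
      (fun x => N.vectorField T QL x (N.loadVoltages x)) (Metric.closedBall (EI, b) r) := by
    refine hfs.comp_graph hlip fun x hx => hρ ?_
    rw [mem_closedBall_iff_norm] at hx
    rw [mem_ball_iff_norm]
    exact max_lt (hx.trans_lt hrρ) ((hxy x hx).trans_lt hrHρ)
  obtain ⟨m, hm, M, hM, hV⟩ := exists_weighted_sum_sq_bounds
    (α := fun i => N.τ i / EI i) (β := fun i => T i / l)
    (fun i => div_pos (N.τ_pos i) (hEI i)) (fun i => div_pos (hT i) hl0)
  obtain ⟨a, ha, _, _, hdec⟩ := exists_weighted_sum_sq_bounds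
    (α := fun _ : I => l) (β := fun i => EL i ^ 2 / (8 * l))
    (fun _ => hl0) (fun i => div_pos (pow_pos (hEL i) 2) (by positivity))
  rw [← hye]
  refine isLocallyExponentiallyStable_of_lyapunov
    (V' := fun x x' => ∑ i, N.τ i / EI i * (2 * (x - (EI, b)).1 i * x'.1 i) +
      ∑ i, T i / l * (2 * (x - (EI, b)).2 i * x'.2 i))
    hr0 hm hM ha (fun x y hx => ?_) hlip hflip
    (fun x x' s t hx => hasDerivWithinAt_weighted_sum_sq (fun i => N.τ i / EI i)
      (fun i => T i / l) (EI, b) hx) (fun x => (hV (x - (EI, b))).1)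
    (fun x => (hV (x - (EI, b))).2) (fun x hx => ?_)
  · have hiff := N.eq_loadVoltages_iff (y := y) (u := x.1) (hx2 x hx)
    constructor
    · rintro ⟨hy, -, hbalance⟩
      exact hiff.2 ((N.loadBalance_eq_zero_iff hy).1 hbalance)
    · rintro rfl
      have hpos (i : L) : 0 < N.loadVoltages x i := by linarith [hhalf x hx i, hEL i]
      exact ⟨hpos, hx1 x hx, (N.loadBalance_eq_zero_iff hpos).2 (hiff.1 rfl)⟩
  · refine (N.lyapunov_derivative_le hT hl0 hl hEL hEI (fun i => by linarith [hbβ i])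
      (fun i => (hbneg i).le) heqI heqL hQ (hbal x (hx2 x hx))
      (fun i => by linarith [hhalf x hx i]) fun i => ?_).trans ?_
    · have h1 : ‖x.1 - EI‖ ≤ r := (norm_fst_le (x - (EI, b))).trans hx
      have h2 : ‖Sum.elim (N.loadVoltages x - EL) (x.1 - EI)‖ ≤ (H + 1) * r := by
        refine (pi_norm_le_iff_of_nonneg (by positivity)).2 ?_
        rintro (j | j)
        · exact (norm_le_pi_norm (N.loadVoltages x - EL) j).trans
            ((hxy x hx).trans (by nlinarith))
        · exact (norm_le_pi_norm (x.1 - EI) j).trans (h1.trans (by nlinarith))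
      have h3 : (N.B *ᵥ Sum.elim (N.loadVoltages x - EL) (x.1 - EI)) (Sum.inr i) ≤
          D * ((H + 1) * r) := by
        refine (le_abs_self _).trans ((norm_le_pi_norm _ (Sum.inr i)).trans ((hD _).trans ?_))
        gcongr
      have h4 : N.K i * (x.1 i - EI i) ≤ |N.K i| * r := by
        refine (le_abs_self _).trans ?_
        rw [abs_mul]
        gcongr
        exact (norm_le_pi_norm (x.1 - EI) i).trans h1
      have h5 := hrsmall i
      linarith
    · linarith [(hdec (x - (EI, b))).1]

end Equilibrium

end Microgrid

/-! ### Assembly of the power flow and stability results. -/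

theorem theorem5 {L I : Type*} [Fintype L] [Fintype I] [DecidableEq L] [DecidableEq I]
    [Nonempty L] [Nonempty I] (N : Microgrid L I) (T : L → ℝ) (hT : ∀ i, 0 < T i) :
    ∃ C > (0 : ℝ), ∀ c : ℝ, 0 < c → c < 1 → ∃ δ > (0 : ℝ),
      ∀ QL : L → ℝ, (∀ i, QL i < 0) → ‖QL‖ < δ →
        ∃ EL b : L → ℝ,
          -- a solution in the positive voltages and negative susceptances, of high voltage
          ((∀ i, 0 < EL i) ∧ (∀ i, b i < 0) ∧ (∀ i, c * N.ELstar i < EL i) ∧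
            N.IsReducedSolution QL EL b) ∧
          -- it is the only one
          (∀ EL' b' : L → ℝ, (∀ i, 0 < EL' i) → (∀ i, b' i < 0) →
            (∀ i, c * N.ELstar i < EL' i) → N.IsReducedSolution QL EL' b' →
            EL' = EL ∧ b' = b) ∧
          -- formulas for this solution
          (∃ ε : L → ℝ, EL = diagonal N.ELstar *ᵥ (1 - N.Qsc⁻¹ *ᵥ QL + ε) ∧
            ‖ε‖ ≤ C * ‖N.Qsc⁻¹ *ᵥ QL‖ ^ 2) ∧
          (b = (diagonal EL ^ 2)⁻¹ *ᵥ QL) ∧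
          -- the corresponding equilibrium of the extended closed loop, and its stability
          (∀ EI : I → ℝ, N.IsEquilibrium T QL EL EI b ↔ EI = N.inverterVoltages EL) ∧
          IsLocallyExponentiallyStable (N.vectorField T QL) N.stateSet
            (N.inverterVoltages EL, b) EL := by
  obtain ⟨C, hC, hflow⟩ := N.exists_unique_highVoltage_solution
  obtain ⟨β, hβ, hstable⟩ := N.exists_isLocallyExponentiallyStable_of_small_susceptance hT
  obtain ⟨μ, hμ, hμle⟩ := exists_pos_forall_le_of_forall_pos fun i => half_pos (N.ELstar_pos i)
  refine ⟨C, hC, fun c hc0 hc1 => ?_⟩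
  obtain ⟨δ, hδ, hsol⟩ := hflow c hc0 hc1
  -- As `EL ≥ ELstar / 2 ≥ μ`, the second bound gives `|b| = |QL| / EL² ≤ β`, whatever `c` is.
  refine ⟨min δ (β * μ ^ 2), lt_min hδ (by positivity), fun QL hneg hQL => ?_⟩
  obtain ⟨EL, b, hEL, huniq, hform, hb, hlow⟩ := hsol QL hneg (hQL.trans_le (min_le_left _ _))
  refine ⟨EL, b, hEL, huniq, hform, ?_, hEL.2.2.2.isEquilibrium_iff hEL.1,
    hstable QL EL b hEL.1 hEL.2.1 (fun i => ?_) hEL.2.2.2⟩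
  · have hinv : (diagonal EL ^ 2)⁻¹ = diagonal fun i => (EL i ^ 2)⁻¹ := by
      refine inv_eq_right_inv ?_
      rw [diagonal_pow, diagonal_mul_diagonal, ← diagonal_one]
      congr 1
      funext i
      exact mul_inv_cancel₀ (pow_ne_zero 2 (hEL.1 i).ne')
    rw [hinv, hb]
    funext i
    rw [mulVec_diagonal, div_eq_inv_mul]
  · have h1 : μ ^ 2 ≤ EL i ^ 2 := by
      gcongr
      exact (hμle i).trans (hlow i)
    have h2 : |QL i| ≤ β * μ ^ 2 :=
      (norm_le_pi_norm QL i).trans (hQL.le.trans (min_le_right _ _))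
    rw [hb]
    simp only
    rw [le_div_iff₀ (pow_pos (hEL.1 i) 2)]
    nlinarith [neg_abs_le (QL i)]
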